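/- Let $G$ be a (finite-dimensional, real, smooth) Lie group with Lie algebra $\mathfrak g$, let $H\subset G$ be a compact connected Lie subgroup with Lie algebra $\mathfrak h\subset\mathfrak g$ and normalised Haar measure $dh$, and let $\langle\cdot,\cdot\rangle$ be an $\mathrm{Ad}_H$-invariant inner product on $\mathfrak g$. Put $\mathfrak m=\mathfrak h^\perp$, and let $\mathfrak m=\mathfrak m_0\oplus\mathfrak m_1\oplus\dots\oplus\mathfrak m_r$ be an orthogonal decomposition into $\mathrm{Ad}_H$-invariant subspaces, where $\mathfrak m_0$ is the space of $\mathrm{Ad}_H$-fixed vectors of $\mathfrak m$ and $\mathfrak m_j$ is irreducible for $j\neq0$. Write $L_{X}$ for differentiation along the left-invariant vector field generated by a Lie algebra element $X$, and, for a subspace $\mathfrak n\subset\mathfrak g$ with orthonormal basis $\{W_i\}$, put $\Delta_{\mathfrak n}=\sum_i L_{W_i}L_{W_i}$. Let $A_1,\dots,A_N\in\mathfrak h$ be such that they and their iterated brackets span $\mathfrak h$, and let $\mathcal L_0=\frac12\sum_{k=1}^N (A_k)^2$, acting on functions on $H$. Let $Y_0\in\mathfrak m_l$ with $l\neq0$.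 Let $\mathfrak m_l\subset\tilde{\mathfrak m}\subset\mathfrak m$ be an $\mathrm{Ad}_H$-invariant subspace (for example $\tilde{\mathfrak m}=\mathfrak m_l$) and $\{Z_j\}$ an orthonormal basis of $\tilde{\mathfrak m}$; set $\alpha_j(h)=\langle \mathrm{Ad}(h)Y_0,Z_j\rangle$ for $h\in H$. Then each Poisson equation $\mathcal L_0u=\alpha_j$ has a solution $u\in C^\infty(H)$. For any choice of smooth solutions, denoted $\mathcal L_0^{-1}\alpha_j$, define the effective generator $$\bar{\mathcal L}=\sum_{i,j}a_{i,j}(Y_0)\,L_{Z_i}L_{Z_j},\qquad a_{i,j}(Y_0)=-\int_H\alpha_i\,\mathcal L_0^{-1}\alpha_j\,dh,$$ acting on $C^2(G;\mathbb R)$. Then the following hold. 1. Let $\{Y_1,\dots,Y_d\}$ be any orthonormal basis of $\mathfrak m_l$ consisting of eigenvectors of $-\frac12\sum_{k}\mathrm{ad}^2(A_k)$, with eigenvalues $\lambda(Y_m)$, and write $Y_0=\sum_{m=1}^d c_mY_m$. Then all $\lambda(Y_m)>0$ and $$\bar{\mathcal L}=\frac1{\dim\mathfrak m_l}\sum_{m=1}^d\frac{c_m^2}{\lambda(Y_m)}\,\Delta_{\mathfrak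 m_l}.$$ 2. If furthermore $\{A_1,\dots,A_N\}$ is an orthonormal basis of $\mathfrak h$, then there is $\lambda_l>0$ with $-\frac12\sum_k\mathrm{ad}^2(A_k)|_{\mathfrak m_l}=\lambda_l\,\mathrm{Id}_{\mathfrak m_l}$, and $$\bar{\mathcal L}=\frac{|Y_0|^2}{\dim(\mathfrak m_l)\,\lambda_l}\,\Delta_{\mathfrak m_l}.$$ -/

import Mathlib

open scoped Manifold ContDiff
open MeasureTheory

namespace EffectiveLimit

noncomputable section

section Group

variable {n : ℕ} {G : Type*} [TopologicalSpace G] [Group G]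
  [ChartedSpace (EuclideanSpace ℝ (Fin n)) G]

/-- A smooth real Lie group has the regularity under which Mathlib endows its tangent space at the
identity with its Lie algebra structure. -/
instance instLieGroupMinSmoothness [LieGroup (𝓡 n) ∞ G] :
    LieGroup (𝓡 n) (minSmoothness ℝ 3) G :=
  LieGroup.of_le (n := ∞) (by
    rw [minSmoothness_of_isRCLikeNormedField]
    exact WithTop.coe_le_coe.mpr le_top)

/-- The derivative `L_{X^*} f` of a function along the left-invariant vector field `X^*`
generated by the Lie algebra element `X`. -/
def lieDeriv (X : GroupLieAlgebra (𝓡 n) G) (f : G → ℝ) (g : G) : ℝ :=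
  mfderiv (𝓡 n) 𝓘(ℝ, ℝ) f g (mulInvariantVectorField X g)

/-- The sum of squares `∑ i, L_{Y_i^*} L_{Y_i^*}`. If `Y` is an orthonormal basis of a subspace `V`
of the Lie algebra, this is the operator `Δ_V`. -/
def sumSquares {d : ℕ} (Y : Fin d → GroupLieAlgebra (𝓡 n) G) (f : G → ℝ) (g : G) : ℝ :=
  ∑ i, lieDeriv (Y i) (lieDeriv (Y i) f) g

variable (n) in
/-- The adjoint action `Ad g` on the Lie algebra: the differential at the identity of the
conjugation `x ↦ g x g⁻¹`, which maps the identity to itself. -/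
def Ad (g : G) : GroupLieAlgebra (𝓡 n) G →ₗ[ℝ] GroupLieAlgebra (𝓡 n) G :=
  (mfderiv (𝓡 n) (𝓡 n) (fun x : G => g * x * g⁻¹) 1).toLinearMap

/-- The linear map `-(1/2) ∑ k, ad²(A_k)` on the Lie algebra. -/
def casimir {N : ℕ} (A : Fin N → GroupLieAlgebra (𝓡 n) G) (X : GroupLieAlgebra (𝓡 n) G) :
    GroupLieAlgebra (𝓡 n) G :=
  -((1 / 2 : ℝ) • ∑ k, ⁅A k, ⁅A k, X⁆⁆)

/-- `Y` is a basis of the subspace `V`, orthonormal for the inner product `B`. -/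
structure IsOrthonormalBasisOf (B : LinearMap.BilinForm ℝ (GroupLieAlgebra (𝓡 n) G))
    (V : Submodule ℝ (GroupLieAlgebra (𝓡 n) G)) {d : ℕ}
    (Y : Fin d → GroupLieAlgebra (𝓡 n) G) : Prop where
  orthonormal : ∀ i j, B (Y i) (Y j) = if i = j then 1 else 0
  span_eq : Submodule.span ℝ (Set.range Y) = V

end Group

section Subgroup

variable {n p : ℕ} {G : Type*} [TopologicalSpace G] [Group G]
  [ChartedSpace (EuclideanSpace ℝ (Fin n)) G]
  (H : Subgroup G) [ChartedSpace (EuclideanSpace ℝ (Fin p)) H]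

variable (n p) in
/-- The inclusion of the Lie algebra of `H` into that of `G`: the differential at the identity of
the inclusion of `H` into `G`. -/
def inclLie : GroupLieAlgebra (𝓡 p) H →ₗ[ℝ] GroupLieAlgebra (𝓡 n) G :=
  (mfderiv (𝓡 p) (𝓡 n) (Subtype.val : H → G) 1).toLinearMap

variable (n p) in
/-- The Lie algebra `𝔥` of `H`, as a subspace of the Lie algebra of `G`. -/
def subLie : Submodule ℝ (GroupLieAlgebra (𝓡 n) G) :=
  LinearMap.range (inclLie n p H)

/-- `B` is an inner product on the Lie algebra of `G` which is invariant under `Ad h`, `h ∈ H`. -/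
structure IsInvariantInnerProduct
    (B : LinearMap.BilinForm ℝ (GroupLieAlgebra (𝓡 n) G)) : Prop where
  symm : ∀ X Y, B X Y = B Y X
  pos : ∀ X, X ≠ 0 → 0 < B X X
  invariant : ∀ h ∈ H, ∀ X Y, B (Ad n h X) (Ad n h Y) = B X Y

/-- The subspace `V` is invariant under `Ad h`, `h ∈ H`. -/
def IsAdInvariant (V : Submodule ℝ (GroupLieAlgebra (𝓡 n) G)) : Prop :=
  ∀ h ∈ H, ∀ X ∈ V, Ad n h X ∈ V

/-- The subspace `V` is an irreducible invariant subspace for the action of `Ad h`, `h ∈ H`. -/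
structure IsAdIrreducible (V : Submodule ℝ (GroupLieAlgebra (𝓡 n) G)) : Prop where
  invariant : IsAdInvariant H V
  ne_bot : V ≠ ⊥
  eq_bot_or_eq : ∀ W ≤ V, IsAdInvariant H W → W = ⊥ ∨ W = V

variable (p) in
/-- The orthogonal complement `𝔪 = 𝔥^⊥`. -/
def compl (B : LinearMap.BilinForm ℝ (GroupLieAlgebra (𝓡 n) G)) :
    Submodule ℝ (GroupLieAlgebra (𝓡 n) G) where
  carrier := {Y | ∀ X ∈ subLie n p H, B X Y = 0}
  add_mem' hX hY Z hZ := by rw [map_add, hX Z hZ, hY Z hZ, add_zero]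
  zero_mem' Z _ := map_zero (B Z)
  smul_mem' c X hX Z hZ := by rw [map_smul, hX Z hZ, smul_zero]

/-- `𝔪 = 𝔪₀ ⊕ 𝔪₁ ⊕ ⋯ ⊕ 𝔪ᵣ` is an orthogonal decomposition of `𝔪 = 𝔥^⊥` into `Ad H`-invariant
subspaces, where `𝔪₀` is the space of the `Ad H`-invariant vectors of `𝔪` and `𝔪ⱼ` is irreducible
for `j ≠ 0`. -/
structure IsIrreducibleDecomposition (p : ℕ) {G : Type*} [TopologicalSpace G] [Group G]
    [ChartedSpace (EuclideanSpace ℝ (Fin n)) G]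
    (H : Subgroup G) [ChartedSpace (EuclideanSpace ℝ (Fin p)) H]
    (B : LinearMap.BilinForm ℝ (GroupLieAlgebra (𝓡 n) G)) {r : ℕ}
    (𝔪 : Fin (r + 1) → Submodule ℝ (GroupLieAlgebra (𝓡 n) G)) : Prop where
  mem_zero_iff : ∀ X, X ∈ 𝔪 0 ↔ X ∈ compl p H B ∧ ∀ h ∈ H, Ad n h X = X
  irreducible : ∀ j, j ≠ 0 → IsAdIrreducible H (𝔪 j)
  orthogonal : ∀ i j, i ≠ j → ∀ X ∈ 𝔪 i, ∀ Y ∈ 𝔪 j, B X Y = 0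
  iSup_eq : ⨆ j, 𝔪 j = compl p H B

/-- The family `A` of elements of `𝔥` and their iterated brackets span `𝔥`. -/
def IsLieGenerating [LieGroup (𝓡 n) ∞ G] {N : ℕ} (A : Fin N → GroupLieAlgebra (𝓡 p) H) : Prop :=
  ∀ X : GroupLieAlgebra (𝓡 n) G,
    X ∈ LieSubalgebra.lieSpan ℝ (GroupLieAlgebra (𝓡 n) G)
      (Set.range fun k => inclLie n p H (A k)) ↔ X ∈ subLie n p H

/-- `u` is a smooth solution on `H` of the Poisson equation `𝓛₀ u = α`, where
`𝓛₀ = (1/2) ∑ k, (A_k)²`. -/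
structure IsPoissonSolution {N : ℕ} (A : Fin N → GroupLieAlgebra (𝓡 p) H) (α u : H → ℝ) :
    Prop where
  smooth : ContMDiff (𝓡 p) 𝓘(ℝ, ℝ) ∞ u
  eq : ∀ h, (1 / 2) * sumSquares A u h = α h

/-- The matrix coefficient `α(Y, Z) (h) = ⟨Ad(h) Y, Z⟩`, a function on `H`. -/
def coeff (B : LinearMap.BilinForm ℝ (GroupLieAlgebra (𝓡 n) G))
    (Y Z : GroupLieAlgebra (𝓡 n) G) (h : H) : ℝ :=
  B (Ad n (h : G) Y) Z

/-- The effective generator `∑ i j, a_{ij} L_{Z_i^*} L_{Z_j^*}` with coefficients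
`a_{ij} = -∫_H α(Y₀, Z_i) 𝓛₀⁻¹(α(Y₀, Z_j)) dh`; here `β j` stands for `𝓛₀⁻¹(α(Y₀, Z_j))`. -/
def effectiveGenerator [MeasurableSpace H] (μ : Measure H)
    (B : LinearMap.BilinForm ℝ (GroupLieAlgebra (𝓡 n) G)) (Y₀ : GroupLieAlgebra (𝓡 n) G) {q : ℕ}
    (Z : Fin q → GroupLieAlgebra (𝓡 n) G) (β : Fin q → H → ℝ) (f : G → ℝ) (g : G) : ℝ :=
  ∑ i, ∑ j, (-∫ h, coeff H B Y₀ (Z i) h * β j h ∂μ) * lieDeriv (Z i) (lieDeriv (Z j) f) g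

end Subgroup

end

end EffectiveLimit

/-! On matrix coefficients of the adjoint representation the Poisson equation becomes linear
algebra. Write `C` for `casimir` of the images of the `A k`, and `α(Y, Z)` for `coeff H B Y Z`.
Since the derivative of `Ad` is the bracket, `𝓛₀ α(Y, Z) = -α(C Y, Z)` (`half_sumSquares_coeff`). By
skewness of `ad`, `B (C X) X` is half the sum of the squared lengths of the `[A k, X]`. If it
vanishes, `X` commutes with `𝔥` by the generating condition and is fixed by `H` by connectedness. A
nonzero vector of `𝔪 l` cannot be fixed, as it would lie in `𝔪 0` and be orthogonal to itself. So
`C` is invertible on `𝔪 l`: `Y₀ = C X`, and `-α(X, Z)` solves the Poisson equation.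

For arbitrary smooth solutions, Haar integration by parts makes `𝓛₀` symmetric and gives `a i j = ∫
α(X, Z i) α(Y₀, Z j)`, independent of the choice. As a form in its two `Z` arguments this is
symmetric and `Ad H`-invariant, so Schur's lemma makes it `κ B` on `𝔪 l`; directions orthogonal to
`𝔪 l` contribute nothing. Taking the trace over `𝔪 l` gives `κ = B X Y₀ / dim 𝔪 l`
(`effectiveGenerator_eq`).

The two formulas differ only in `X`. In an eigenbasis it is `∑ (c m / lam m) • Y m`. When `A` is
orthonormal, `C` commutes with `Ad H`, so a second use of Schur makes it a scalar on `𝔪 l`. -/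

namespace EffectiveLimit

open Filter Topology

/-! ### Orthonormal expansions and a real Schur lemma for symmetric forms -/

section LinearAlgebra

variable {E : Type*} [AddCommGroup E] [Module ℝ E] {B : LinearMap.BilinForm ℝ E}
  {V : Submodule ℝ E} {d : ℕ} {Y : Fin d → E}

theorem eq_sum_of_orthonormal (hY : ∀ i j, B (Y i) (Y j) = if i = j then 1 else 0) {X : E}
    (hX : X ∈ Submodule.span ℝ (Set.range Y)) : X = ∑ i, B X (Y i) • Y i := by
  obtain ⟨c, rfl⟩ := (Submodule.mem_span_range_iff_exists_fun ℝ).1 hX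
  refine Finset.sum_congr rfl fun i _ => ?_
  congr 1
  simp [hY]

theorem bilin_eq_sum_of_orthonormal (hY : ∀ i j, B (Y i) (Y j) = if i = j then 1 else 0) {X : E}
    (hX : X ∈ Submodule.span ℝ (Set.range Y)) (X' : E) :
    B X X' = ∑ i, B X (Y i) * B (Y i) X' := by
  conv_lhs => rw [eq_sum_of_orthonormal hY hX]
  simp

theorem linearIndependent_of_orthonormal
    (hY : ∀ i j, B (Y i) (Y j) = if i = j then 1 else 0) : LinearIndependent ℝ Y := by
  rw [Fintype.linearIndependent_iff]
  intro c hc i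
  have := congrArg (fun X => B X (Y i)) hc
  simpa [hY] using this

theorem finrank_of_orthonormal (hY : ∀ i j, B (Y i) (Y j) = if i = j then 1 else 0)
    (hspan : Submodule.span ℝ (Set.range Y) = V) : Module.finrank ℝ V = d := by
  rw [← hspan, finrank_span_eq_card (linearIndependent_of_orthonormal hY), Fintype.card_fin]

/-- A symmetric invariant bilinear form on an irreducible orthogonal representation is a multiple
of the inner product. -/
theorem exists_eq_mul_of_irreducible {K : Type*} [Group K] {ρ : K → E →ₗ[ℝ] E}
    (hρ : ∀ k X, ρ k (ρ k⁻¹ X) = X) (hVρ : ∀ k, ∀ X ∈ V, ρ k X ∈ V) (hV : V ≠ ⊥)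
    (hirr : ∀ W ≤ V, (∀ k, ∀ X ∈ W, ρ k X ∈ W) → W = ⊥ ∨ W = V)
    (hB : ∀ k X X', B (ρ k X) (ρ k X') = B X X')
    (hY : ∀ i j, B (Y i) (Y j) = if i = j then 1 else 0)
    (hspan : Submodule.span ℝ (Set.range Y) = V) {S : LinearMap.BilinForm ℝ E}
    (hsymm : ∀ X ∈ V, ∀ X' ∈ V, S X X' = S X' X)
    (hS : ∀ k, ∀ X ∈ V, ∀ X' ∈ V, S (ρ k X) (ρ k X') = S X X') :
    ∃ κ : ℝ, ∀ X ∈ V, ∀ X' ∈ V, S X X' = κ * B X X' := by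
  have hYV : ∀ i, Y i ∈ V := fun i => hspan ▸ Submodule.subset_span ⟨i, rfl⟩
  have hM : (Matrix.of fun i j => S (Y i) (Y j)).IsHermitian := by
    ext i j
    simp [hsymm _ (hYV j) _ (hYV i)]
  have hd : Nonempty (Fin d) := by
    by_contra h
    rw [not_nonempty_iff] at h
    exact hV (by rw [← hspan, Set.range_eq_empty, Submodule.span_empty])
  obtain ⟨i₀⟩ := hd
  -- A real symmetric Gram matrix has a real eigenvalue, so no complexification is needed. Its
  -- eigenspace `W`, taken relative to `B`, is invariant and nonzero, hence all of `V`.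
  set κ := hM.eigenvalues i₀ with hκ
  set v := hM.eigenvectorBasis i₀ with hv
  have hvne : v ≠ 0 := hM.eigenvectorBasis.orthonormal.ne_zero i₀
  have hmul := hM.mulVec_eigenvectorBasis i₀
  let W : Submodule ℝ E :=
    { carrier := {X | X ∈ V ∧ ∀ X' ∈ V, S X X' = κ * B X X'}
      add_mem' := fun {X₁ X₂} h₁ h₂ => ⟨V.add_mem h₁.1 h₂.1, fun X' hX' => by
        rw [map_add, map_add, LinearMap.add_apply, LinearMap.add_apply, h₁.2 X' hX', h₂.2 X' hX',
          mul_add]⟩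
      zero_mem' := ⟨V.zero_mem, fun X' _ => by simp⟩
      smul_mem' := fun c X h => ⟨V.smul_mem c h.1, fun X' hX' => by
        simp only [map_smul, LinearMap.smul_apply, h.2 X' hX', smul_eq_mul]; ring⟩ }
  have hWV : W = V := by
    refine (hirr W (fun X hX => hX.1) fun k X hX => ⟨hVρ k X hX.1, fun X' hX' => ?_⟩).resolve_left
      fun hbot => hvne ?_
    · have h := hVρ k⁻¹ X' hX'
      rw [← hρ k X', hS k X hX.1 _ h, hB, hX.2 _ h]
    · have hmem : ∑ i, v i • Y i ∈ W := by
        refine ⟨V.sum_mem fun i _ => V.smul_mem _ (hYV i), fun X' hX' => ?_⟩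
        suffices h : ∀ j, S (∑ i, v i • Y i) (Y j) = κ * B (∑ i, v i • Y i) (Y j) by
          obtain ⟨c, rfl⟩ := (Submodule.mem_span_range_iff_exists_fun ℝ).1 (hspan ▸ hX')
          simp only [map_sum, map_smul, smul_eq_mul, Finset.mul_sum] at h ⊢
          refine Finset.sum_congr rfl fun j _ => ?_
          rw [h j]
          ring
        intro j
        have hj := congrFun hmul j
        simp only [Matrix.mulVec, dotProduct, Matrix.of_apply, Pi.smul_apply, smul_eq_mul] at hj
        simp only [map_sum, map_smul, LinearMap.sum_apply, LinearMap.smul_apply, smul_eq_mul, hY,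
          mul_ite, mul_one, mul_zero, Finset.sum_ite_eq', Finset.mem_univ, if_true]
        rw [hκ, hv, ← hj]
        refine Finset.sum_congr rfl fun i _ => ?_
        rw [hsymm _ (hYV i) _ (hYV j), mul_comm]
      rw [hbot, Submodule.mem_bot] at hmem
      have := Fintype.linearIndependent_iff.1 (linearIndependent_of_orthonormal hY) _ hmem
      ext i
      simpa using this i
  exact ⟨κ, fun X hX => (hWV ▸ hX : X ∈ W).2⟩

end LinearAlgebra

/-! ### Second derivatives of a local product -/

section Calculus

variable {E : Type*} [NormedAddCommGroup E] [NormedSpace ℝ E]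

/-- If the two partial derivatives of a local product `m` with unit `x₀` are related by `T`, then
the derivative of `T` at `x₀` is the antisymmetrised mixed second derivative of `m`. -/
theorem fderiv_eq_sub_of_partial_derivatives {m : E × E → E} {x₀ : E} (hm : ContDiffAt ℝ 2 m (x₀, x₀))
    (hunit : ∀ᶠ x in 𝓝 x₀, m (x, x₀) = x) {T : E → E} (hT : DifferentiableAt ℝ T x₀) {Y : E}
    (hTY : T x₀ = Y)
    (h : ∀ᶠ x in 𝓝 x₀, fderiv ℝ (fun y => m (x, y)) x₀ Y = fderiv ℝ (fun y => m (y, x)) x₀ (T x))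
    (X : E) :
    fderiv ℝ T x₀ X = fderiv ℝ (fun x => fderiv ℝ (fun y => m (x, y)) x₀ Y) x₀ X
      - fderiv ℝ (fun x => fderiv ℝ (fun y => m (x, y)) x₀ X) x₀ Y := by
  have hd : ∀ᶠ p in 𝓝 (x₀, x₀), DifferentiableAt ℝ m p :=
    (hm.eventually (by simp)).mono fun p hp => hp.differentiableAt (by simp)
  have hl : Tendsto (fun x : E => (x, x₀)) (𝓝 x₀) (𝓝 (x₀, x₀)) :=
    (Continuous.prodMk_left x₀).tendsto x₀
  have hr : Tendsto (fun x : E => (x₀, x)) (𝓝 x₀) (𝓝 (x₀, x₀)) :=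
    (Continuous.prodMk_right x₀).tendsto x₀
  have h₂ : ∀ Z, (fun x => fderiv ℝ (fun y => m (x, y)) x₀ Z) =ᶠ[𝓝 x₀]
      fun x => fderiv ℝ m (x, x₀) (0, Z) := fun Z => (hl.eventually hd).mono fun x hx => by
    have := HasFDerivAt.comp (f := fun y => (x, y)) x₀ hx.hasFDerivAt (hasFDerivAt_prodMk_right x x₀)
    exact congrArg (fun L : E →L[ℝ] E => L Z) this.fderiv
  have h₁ : ∀ᶠ x in 𝓝 x₀, ∀ Z, fderiv ℝ (fun y => m (y, x)) x₀ Z = fderiv ℝ m (x₀, x) (Z, 0) :=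
    (hr.eventually hd).mono fun x hx Z => by
    have := HasFDerivAt.comp (f := fun y => (y, x)) x₀ hx.hasFDerivAt (hasFDerivAt_prodMk_left x₀ x)
    exact congrArg (fun L : E →L[ℝ] E => L Z) this.fderiv
  have hm' : HasFDerivAt (fderiv ℝ m) (fderiv ℝ (fderiv ℝ m) (x₀, x₀)) (x₀, x₀) :=
    ((hm.fderiv_right (m := 1) (by norm_num)).differentiableAt (by simp)).hasFDerivAt
  have hsymm := hm.isSymmSndFDerivAt (by simp)
  have e₂ : ∀ Z W, fderiv ℝ (fun x => fderiv ℝ (fun y => m (x, y)) x₀ Z) x₀ W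
      = fderiv ℝ (fderiv ℝ m) (x₀, x₀) (W, 0) (0, Z) := fun Z W => by
    rw [(h₂ Z).fderiv_eq]
    have := (HasFDerivAt.comp (f := fun x => (x, x₀)) x₀ hm' (hasFDerivAt_prodMk_left x₀ x₀)).clm_apply
      (hasFDerivAt_const ((0 : E), Z) x₀)
    refine (congrArg (fun L : E →L[ℝ] E => L W) this.fderiv).trans ?_
    simp
  have hid : ∀ Z, fderiv ℝ m (x₀, x₀) (Z, 0) = Z := fun Z => by
    rw [← h₁.self_of_nhds Z, EventuallyEq.fderiv_eq (𝕜 := ℝ)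
      (hunit : (fun x => m (x, x₀)) =ᶠ[𝓝 x₀] fun y => y), fderiv_fun_id]
    rfl
  have e₁ : fderiv ℝ (fun x => fderiv ℝ m (x₀, x) (T x, 0)) x₀ X
      = fderiv ℝ (fderiv ℝ m) (x₀, x₀) (0, X) (Y, 0) + fderiv ℝ T x₀ X := by
    have := (HasFDerivAt.comp (f := fun x => (x₀, x)) x₀ hm'
      (hasFDerivAt_prodMk_right x₀ x₀)).clm_apply
      (hT.hasFDerivAt.prodMk (hasFDerivAt_const (0 : E) x₀))
    refine (congrArg (fun L : E →L[ℝ] E => L X) this.fderiv).trans ?_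
    simp [hTY, hid, add_comm]
  -- Differentiate both sides along `X`. The first partial derivative of `m` is the identity at
  -- `(x₀, x₀)`, so the right side yields the derivative of `T` plus a mixed second derivative,
  -- whose two arguments are then swapped by symmetry.
  have e : (fun x => fderiv ℝ (fun y => m (x, y)) x₀ Y) =ᶠ[𝓝 x₀]
      fun x => fderiv ℝ m (x₀, x) (T x, 0) := by
    filter_upwards [h, h₁] with x hx hx₁
    rw [hx, hx₁]
  rw [e.fderiv_eq, e₁, e₂, hsymm.eq]
  abel

end Calculus

/-! ### Derivatives between manifolds with values in the model spaces -/

section CoordinateDerivative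

variable {E : Type*} [NormedAddCommGroup E] [NormedSpace ℝ E]
  {H : Type*} [TopologicalSpace H] (I : ModelWithCorners ℝ E H)
  {E' : Type*} [NormedAddCommGroup E'] [NormedSpace ℝ E']
  {H' : Type*} [TopologicalSpace H'] (I' : ModelWithCorners ℝ E' H')
  {E'' : Type*} [NormedAddCommGroup E''] [NormedSpace ℝ E'']
  {H'' : Type*} [TopologicalSpace H''] (I'' : ModelWithCorners ℝ E'' H'')
  {M : Type*} [TopologicalSpace M] [ChartedSpace H M]
  {M' : Type*} [TopologicalSpace M'] [ChartedSpace H' M']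
  {M'' : Type*} [TopologicalSpace M''] [ChartedSpace H'' M'']

/-- The derivative of a map between manifolds, as a map between the model vector spaces. -/
noncomputable def coordDeriv (f : M → M') (x : M) : E →L[ℝ] E' := mfderiv I I' f x

variable {I I' I''}

/-- Values in the model space let `f x` be replaced by an equal point `y`, such as `g * 1 * g⁻¹` by
`1`, without transport between tangent spaces. -/
theorem coordDeriv_comp {f : M → M'} {g : M' → M''} {x : M} {y : M'} (hy : f x = y)
    (hg : MDifferentiableAt I' I'' g y) (hf : MDifferentiableAt I I' f x) (v : E) :
    coordDeriv I I'' (fun z => g (f z)) x v = coordDeriv I' I'' g y (coordDeriv I I' f x v) := by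
  subst hy
  exact congrArg (fun L : E →L[ℝ] E'' => L v) (mfderiv_comp x hg hf)

theorem coordDeriv_id (x : M) (v : E) : coordDeriv I I (fun y : M => y) x v = v :=
  congrArg (fun L : E →L[ℝ] E => L v) (mfderiv_id (x := x))

theorem coordDeriv_const (x : M) (y : M') (v : E) : coordDeriv I I' (fun _ : M => y) x v = 0 :=
  congrArg (fun L : E →L[ℝ] E' => L v) (mfderiv_const (x := x) (c := y))

theorem coordDeriv_eq_fderiv (f : E → E') (x : E) :
    coordDeriv 𝓘(ℝ, E) 𝓘(ℝ, E') f x = fderiv ℝ f x :=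
  mfderiv_eq_fderiv

theorem coordDeriv_eq_fderiv_comp_symm [I.Boundaryless] {f : M → E'} {x : M}
    (hf : MDifferentiableAt I 𝓘(ℝ, E') f x) :
    coordDeriv I 𝓘(ℝ, E') f x
      = fderiv ℝ (fun y => f ((extChartAt I x).symm y)) (extChartAt I x x) := by
  refine (MDifferentiableAt.mfderiv hf).trans ?_
  rw [I.range_eq_univ, fderivWithin_univ]
  rfl

theorem coordDeriv_extChartAt_of_eq [IsManifold I 1 M] {x y : M} (h : y = x) :
    coordDeriv I 𝓘(ℝ, E) (extChartAt I x) y = ContinuousLinearMap.id ℝ E := by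
  subst h
  exact mfderiv_extChartAt_self

end CoordinateDerivative

/-! ### The adjoint representation and its smoothness -/

section AdjointAction

variable {n : ℕ} {G : Type*} [TopologicalSpace G] [Group G]
  [ChartedSpace (EuclideanSpace ℝ (Fin n)) G] [LieGroup (𝓡 n) ∞ G]

theorem mdifferentiable_mul_left (g : G) : MDifferentiable (𝓡 n) (𝓡 n) fun x : G => g * x :=
  (contMDiff_mul_left (I := 𝓡 n) (n := ∞)).mdifferentiable (by simp)

theorem mdifferentiable_mul_right (g : G) : MDifferentiable (𝓡 n) (𝓡 n) fun x : G => x * g :=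
  (contMDiff_mul_right (I := 𝓡 n) (n := ∞)).mdifferentiable (by simp)

theorem mdifferentiable_conj (g : G) : MDifferentiable (𝓡 n) (𝓡 n) fun x : G => g * x * g⁻¹ :=
  (mdifferentiable_mul_right g⁻¹).comp (mdifferentiable_mul_left g)

omit [LieGroup (𝓡 n) ∞ G] in
theorem Ad_eq (g : G) (X : GroupLieAlgebra (𝓡 n) G) :
    Ad n g X = coordDeriv (𝓡 n) (𝓡 n) (fun x : G => g * x * g⁻¹) 1 X := rfl

omit [LieGroup (𝓡 n) ∞ G] in
theorem Ad_one (X : GroupLieAlgebra (𝓡 n) G) : Ad n (1 : G) X = X := by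
  refine Eq.trans ?_ (coordDeriv_id (I := 𝓡 n) (1 : G) X)
  rw [Ad_eq]
  congr 2
  ext x
  simp

theorem Ad_mul (g h : G) (X : GroupLieAlgebra (𝓡 n) G) : Ad n (g * h) X = Ad n g (Ad n h X) := by
  refine Eq.trans ?_ (coordDeriv_comp (f := fun x : G => h * x * h⁻¹) (g := fun x : G => g * x * g⁻¹)
    (x := 1) (y := 1) (by simp) (mdifferentiable_conj g 1) (mdifferentiable_conj h 1) X)
  rw [Ad_eq]
  congr 2
  ext x
  group

theorem contMDiff_coordDeriv_conj (X : EuclideanSpace ℝ (Fin n)) :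
    ContMDiff (𝓡 n) 𝓘(ℝ, EuclideanSpace ℝ (Fin n)) ∞
      fun g : G => coordDeriv (𝓡 n) (𝓡 n) (fun x : G => g * x * g⁻¹) 1 X := by
  intro g₀
  have hf : ContMDiffAt ((𝓡 n).prod (𝓡 n)) (𝓡 n) ∞
      (Function.uncurry fun g x : G => g * x * g⁻¹) (g₀, 1) := by
    have : ContMDiff ((𝓡 n).prod (𝓡 n)) (𝓡 n) ∞ fun p : G × G => p.1 * p.2 * p.1⁻¹ :=
      (contMDiff_fst.mul contMDiff_snd).mul contMDiff_fst.inv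
    exact this.contMDiffAt
  have h := ContMDiffAt.mfderiv_apply (m := ∞) (fun g x : G => g * x * g⁻¹) (fun _ => 1) id
    (fun _ => X) hf contMDiffAt_const contMDiffAt_id contMDiffAt_const le_rfl
  refine h.congr_of_eventuallyEq (Eventually.of_forall fun g => ?_)
  -- Conjugation fixes `1`, so both coordinate changes are derivatives of a chart, or its inverse,
  -- at its own centre: they are identities.
  have e := inTangentCoordinates_eq_mfderiv_comp (I := 𝓡 n) (I' := 𝓡 n) (N := G) (f := fun _ => (1 : G))
    (g := fun g : G => g * 1 * g⁻¹) (ϕ := fun g => mfderiv (𝓡 n) (𝓡 n) (fun x : G => g * x * g⁻¹) 1)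
    (x₀ := g₀) (x := g) (mem_chart_source _ _) (by simp)
  refine Eq.trans ?_ (congrArg (fun L : EuclideanSpace ℝ (Fin n) →L[ℝ] EuclideanSpace ℝ (Fin n) => L X) e).symm
  have e₁ := coordDeriv_extChartAt_of_eq (I := 𝓡 n) (x := g₀ * 1 * g₀⁻¹) (y := g * 1 * g⁻¹) (by simp)
  have e₂ := mfderivWithin_range_extChartAt_symm (I := 𝓡 n) (x := (1 : G))
  have := congrArg (fun L : EuclideanSpace ℝ (Fin n) →L[ℝ] EuclideanSpace ℝ (Fin n) =>
    L (coordDeriv (𝓡 n) (𝓡 n) (fun x : G => g * x * g⁻¹) 1 X)) e₁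
  refine this.symm.trans ?_
  have := congrArg (fun L : EuclideanSpace ℝ (Fin n) →L[ℝ] EuclideanSpace ℝ (Fin n) =>
    coordDeriv (𝓡 n) 𝓘(ℝ, EuclideanSpace ℝ (Fin n)) (extChartAt (𝓡 n) (g₀ * 1 * g₀⁻¹)) (g * 1 * g⁻¹)
      (coordDeriv (𝓡 n) (𝓡 n) (fun x : G => g * x * g⁻¹) 1 (L X))) e₂
  exact this.symm

end AdjointAction

/-! ### The differential of `Ad` at the identity is the bracket -/

section Bracket

variable {n : ℕ} {G : Type*} [TopologicalSpace G] [Group G]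
  [ChartedSpace (EuclideanSpace ℝ (Fin n)) G]

variable (G) in
/-- The left-invariant vector field generated by `Z`, in the chart at the identity. -/
noncomputable def invariantFieldInChart (Z : EuclideanSpace ℝ (Fin n)) :
    EuclideanSpace ℝ (Fin n) → EuclideanSpace ℝ (Fin n) :=
  VectorField.mpullbackWithin 𝓘(ℝ, EuclideanSpace ℝ (Fin n)) (𝓡 n) (extChartAt (𝓡 n) (1 : G)).symm
    (mulInvariantVectorField (I := 𝓡 n) (G := G) Z) Set.univ

variable [LieGroup (𝓡 n) ∞ G]

theorem invariantFieldInChart_eq (Z : EuclideanSpace ℝ (Fin n)) {x : EuclideanSpace ℝ (Fin n)}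
    (hx : x ∈ (extChartAt (𝓡 n) (1 : G)).target) :
    invariantFieldInChart G Z x
      = coordDeriv (𝓡 n) 𝓘(ℝ, EuclideanSpace ℝ (Fin n)) (extChartAt (𝓡 n) (1 : G))
        ((extChartAt (𝓡 n) (1 : G)).symm x)
        (coordDeriv (𝓡 n) (𝓡 n) (fun y : G => (extChartAt (𝓡 n) (1 : G)).symm x * y) 1 Z) := by
  refine (VectorField.mpullbackWithin_apply ..).trans ?_
  have h₁ := mfderivWithin_extChartAt_symm_comp_mfderiv_extChartAt hx
  have h₂ := mfderiv_extChartAt_comp_mfderivWithin_extChartAt_symm hx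
  rw [ModelWithCorners.range_eq_univ] at h₁ h₂
  rw [ContinuousLinearMap.inverse_eq h₁ h₂]
  rfl

omit [LieGroup (𝓡 n) ∞ G] in
theorem sub_fderiv_invariantFieldInChart [IsManifold (𝓡 n) 1 G] (X Y : GroupLieAlgebra (𝓡 n) G) :
    fderiv ℝ (invariantFieldInChart G Y) (extChartAt (𝓡 n) (1 : G) 1)
        (invariantFieldInChart G X (extChartAt (𝓡 n) (1 : G) 1))
      - fderiv ℝ (invariantFieldInChart G X) (extChartAt (𝓡 n) (1 : G) 1)
        (invariantFieldInChart G Y (extChartAt (𝓡 n) (1 : G) 1)) = ⁅X, Y⁆ := by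
  rw [GroupLieAlgebra.bracket_def]
  have h : ∀ v : EuclideanSpace ℝ (Fin n),
      (mfderiv (𝓡 n) 𝓘(ℝ, EuclideanSpace ℝ (Fin n)) (extChartAt (𝓡 n) (1 : G)) 1).inverse v = v :=
    fun v => by
      rw [mfderiv_extChartAt_self]
      exact congrArg (fun L : EuclideanSpace ℝ (Fin n) →L[ℝ] EuclideanSpace ℝ (Fin n) => L v)
        ContinuousLinearMap.inverse_id
  refine Eq.trans ?_ (h _).symm
  rw [Set.preimage_univ, ModelWithCorners.range_eq_univ, Set.univ_inter]
  exact (congrFun (VectorField.lieBracketWithin_univ (𝕜 := ℝ) (V := invariantFieldInChart G X)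
    (W := invariantFieldInChart G Y)) (extChartAt (𝓡 n) (1 : G) 1)).symm

/-- The derivative of the adjoint action at the identity is the Lie bracket. -/
theorem coordDeriv_conj_one (X Y : EuclideanSpace ℝ (Fin n)) :
    coordDeriv (𝓡 n) 𝓘(ℝ, EuclideanSpace ℝ (Fin n))
      (fun g : G => coordDeriv (𝓡 n) (𝓡 n) (fun x : G => g * x * g⁻¹) 1 Y) 1 X =
    fderiv ℝ (invariantFieldInChart G Y) (extChartAt (𝓡 n) (1 : G) 1)
        (invariantFieldInChart G X (extChartAt (𝓡 n) (1 : G) 1))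
      - fderiv ℝ (invariantFieldInChart G X) (extChartAt (𝓡 n) (1 : G) 1)
        (invariantFieldInChart G Y (extChartAt (𝓡 n) (1 : G) 1)) := by
  set φ := extChartAt (𝓡 n) (1 : G) with hφ
  set x₀ := φ 1 with hx₀
  let m : EuclideanSpace ℝ (Fin n) × EuclideanSpace ℝ (Fin n) → EuclideanSpace ℝ (Fin n) :=
    fun p => φ (φ.symm p.1 * φ.symm p.2)
  have hsymm₀ : φ.symm x₀ = 1 := extChartAt_to_inv 1
  have hsymm : ContMDiffAt 𝓘(ℝ, EuclideanSpace ℝ (Fin n)) (𝓡 n) ∞ φ.symm x₀ :=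
    (contMDiffOn_extChartAt_symm 1).contMDiffAt (extChartAt_target_mem_nhds 1)
  have htarget : ∀ᶠ x in 𝓝 x₀, x ∈ φ.target := extChartAt_target_mem_nhds 1
  have hm : ContDiffAt ℝ ∞ m (x₀, x₀) := by
    rw [← contMDiffAt_iff_contDiffAt]
    have h₁ := ContMDiffAt.comp (x₀, x₀) (g := φ.symm)
      (f := fun p : EuclideanSpace ℝ (Fin n) × EuclideanSpace ℝ (Fin n) => p.1) hsymm
      (contDiffAt_fst.contMDiffAt)
    have h₂ := ContMDiffAt.comp (x₀, x₀) (g := φ.symm)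
      (f := fun p : EuclideanSpace ℝ (Fin n) × EuclideanSpace ℝ (Fin n) => p.2) hsymm
      (contDiffAt_snd.contMDiffAt)
    refine ContMDiffAt.comp_of_eq (x := (x₀, x₀)) (g := φ) (y := 1) contMDiffAt_extChartAt (h₁.mul h₂) ?_
    simp [hsymm₀]
  have hunit : ∀ᶠ x in 𝓝 x₀, m (x, x₀) = x := htarget.mono fun x hx => by
    simp only [m, hsymm₀, mul_one]
    exact φ.right_inv hx
  have hAd := contMDiff_coordDeriv_conj (G := G) Y
  have hT : DifferentiableAt ℝ
      (fun x => coordDeriv (𝓡 n) (𝓡 n) (fun y : G => φ.symm x * y * (φ.symm x)⁻¹) 1 Y) x₀ := by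
    rw [← mdifferentiableAt_iff_differentiableAt]
    exact (hAd.contMDiffAt.comp x₀ hsymm).mdifferentiableAt (by simp)
  have hφd : ∀ {x}, x ∈ φ.target → MDifferentiableAt (𝓡 n) 𝓘(ℝ, EuclideanSpace ℝ (Fin n)) φ (φ.symm x) :=
    fun hx => mdifferentiableAt_extChartAt (by
      rw [← extChartAt_source (𝓡 n)]
      exact φ.map_target hx)
  have hφl : ∀ {x}, x ∈ φ.target → MDifferentiableAt (𝓡 n) 𝓘(ℝ, EuclideanSpace ℝ (Fin n))
      (fun k => φ (φ.symm x * k)) 1 := fun {x} hx =>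
    MDifferentiableAt.comp_of_eq (y := φ.symm x) _ (hφd hx) (mdifferentiable_mul_left (φ.symm x) 1)
      (mul_one _)
  have hφr : ∀ {x}, x ∈ φ.target → MDifferentiableAt (𝓡 n) 𝓘(ℝ, EuclideanSpace ℝ (Fin n))
      (fun k => φ (k * φ.symm x)) 1 := fun {x} hx =>
    MDifferentiableAt.comp_of_eq (y := φ.symm x) _ (hφd hx) (mdifferentiable_mul_right (φ.symm x) 1)
      (one_mul _)
  have hleft : ∀ {x}, x ∈ φ.target → ∀ Z, fderiv ℝ (fun y => m (x, y)) x₀ Z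
      = coordDeriv (𝓡 n) 𝓘(ℝ, EuclideanSpace ℝ (Fin n)) (fun k => φ (φ.symm x * k)) 1 Z :=
    fun {x} hx Z => by rw [coordDeriv_eq_fderiv_comp_symm (hφl hx)]
  have hright : ∀ {x}, x ∈ φ.target → ∀ Z, fderiv ℝ (fun y => m (y, x)) x₀ Z
      = coordDeriv (𝓡 n) 𝓘(ℝ, EuclideanSpace ℝ (Fin n)) (fun k => φ (k * φ.symm x)) 1 Z :=
    fun {x} hx Z => by rw [coordDeriv_eq_fderiv_comp_symm (hφr hx)]
  have hinv : ∀ Z, (fun x => fderiv ℝ (fun y => m (x, y)) x₀ Z) =ᶠ[𝓝 x₀] invariantFieldInChart G Z :=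
    fun Z => htarget.mono fun x hx => by
      rw [invariantFieldInChart_eq Z hx]
      exact (hleft hx Z).trans
        (coordDeriv_comp (mul_one _) (hφd hx) (mdifferentiable_mul_left _ 1) Z)
  -- Here `T x` is `Ad g Y` with `g = φ.symm x`. Since `g * k = (g * k * g⁻¹) * g`, left translation
  -- of `Y` by `g` equals right translation of `Ad g Y`.
  have key := fderiv_eq_sub_of_partial_derivatives (Y := Y)
    (hm.of_le (WithTop.coe_le_coe.mpr le_top)) hunit hT
    (by
      rw [hsymm₀]
      exact Ad_one (G := G) Y)
    (htarget.mono fun x hx => by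
      rw [hleft hx, hright hx, ← coordDeriv_comp (by simp) (hφr hx)
        (mdifferentiable_conj (φ.symm x) 1)]
      simp only [inv_mul_cancel_right]) X
  rw [coordDeriv_eq_fderiv_comp_symm (hAd.mdifferentiable (by simp) 1)]
  have hval : ∀ Z, invariantFieldInChart G Z x₀ = Z := fun Z => by
    rw [← (hinv Z).self_of_nhds]
    have : (fun y => m (x₀, y)) =ᶠ[𝓝 x₀] fun y => y := by
      filter_upwards [htarget] with y hy
      simp only [m, hsymm₀, one_mul]
      exact φ.right_inv hy
    simp only [this.fderiv_eq, fderiv_fun_id]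
    rfl
  rw [hval, hval, ← (hinv Y).fderiv_eq, ← (hinv X).fderiv_eq]
  exact key

theorem coordDeriv_conj_one_eq_lie (X Y : GroupLieAlgebra (𝓡 n) G) :
    coordDeriv (𝓡 n) 𝓘(ℝ, EuclideanSpace ℝ (Fin n))
      (fun g : G => coordDeriv (𝓡 n) (𝓡 n) (fun x : G => g * x * g⁻¹) 1 Y) 1 X = ⁅X, Y⁆ :=
  (coordDeriv_conj_one X Y).trans (sub_fderiv_invariantFieldInChart X Y)

end Bracket

/-! ### Calculus of left-invariant derivatives -/

section LieDerivative

variable {n : ℕ} {G : Type*} [TopologicalSpace G] [Group G]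
  [ChartedSpace (EuclideanSpace ℝ (Fin n)) G]

theorem lieDeriv_add_left (X Y : GroupLieAlgebra (𝓡 n) G) (f : G → ℝ) (g : G) :
    lieDeriv (X + Y) f g = lieDeriv X f g + lieDeriv Y f g := by
  unfold lieDeriv
  rw [mulInvariantVectorField_add]
  exact map_add (coordDeriv (𝓡 n) 𝓘(ℝ, ℝ) f g) _ _

theorem lieDeriv_smul_left (c : ℝ) (X : GroupLieAlgebra (𝓡 n) G) (f : G → ℝ) (g : G) :
    lieDeriv (c • X) f g = c * lieDeriv X f g := by
  unfold lieDeriv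
  rw [mulInvariantVectorField_smul]
  exact map_smul (coordDeriv (𝓡 n) 𝓘(ℝ, ℝ) f g) _ _

theorem lieDeriv_sum_left {ι : Type*} (s : Finset ι) (c : ι → ℝ) (X : ι → GroupLieAlgebra (𝓡 n) G)
    (f : G → ℝ) (g : G) :
    lieDeriv (∑ i ∈ s, c i • X i) f g = ∑ i ∈ s, c i * lieDeriv (X i) f g := by
  classical
  induction s using Finset.induction_on with
  | empty =>
    rw [Finset.sum_empty, Finset.sum_empty]
    simpa using lieDeriv_smul_left 0 (0 : GroupLieAlgebra (𝓡 n) G) f g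
  | insert i s hi ih =>
    rw [Finset.sum_insert hi, Finset.sum_insert hi, lieDeriv_add_left, lieDeriv_smul_left, ih]

theorem lieDeriv_const (X : GroupLieAlgebra (𝓡 n) G) (c : ℝ) (g : G) :
    lieDeriv X (fun _ => c) g = 0 :=
  coordDeriv_const (I := 𝓡 n) (I' := 𝓘(ℝ, ℝ)) (E := EuclideanSpace ℝ (Fin n)) g c
    (mulInvariantVectorField X g)

theorem lieDeriv_add {f₁ f₂ : G → ℝ} {g : G} (h₁ : MDifferentiableAt (𝓡 n) 𝓘(ℝ, ℝ) f₁ g)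
    (h₂ : MDifferentiableAt (𝓡 n) 𝓘(ℝ, ℝ) f₂ g) (X : GroupLieAlgebra (𝓡 n) G) :
    lieDeriv X (fun x => f₁ x + f₂ x) g = lieDeriv X f₁ g + lieDeriv X f₂ g :=
  congrArg (fun L : EuclideanSpace ℝ (Fin n) →L[ℝ] ℝ => L (mulInvariantVectorField X g))
    (mfderiv_add h₁ h₂)

theorem lieDeriv_mul {f₁ f₂ : G → ℝ} {g : G} (h₁ : MDifferentiableAt (𝓡 n) 𝓘(ℝ, ℝ) f₁ g)
    (h₂ : MDifferentiableAt (𝓡 n) 𝓘(ℝ, ℝ) f₂ g) (X : GroupLieAlgebra (𝓡 n) G) :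
    lieDeriv X (fun x => f₁ x * f₂ x) g = f₁ g * lieDeriv X f₂ g + f₂ g * lieDeriv X f₁ g :=
  congrArg (fun L : EuclideanSpace ℝ (Fin n) →L[ℝ] ℝ => L (mulInvariantVectorField X g))
    (h₁.hasMFDerivAt.mul h₂.hasMFDerivAt).mfderiv

theorem lieDeriv_const_mul {f : G → ℝ} {g : G} (h : MDifferentiableAt (𝓡 n) 𝓘(ℝ, ℝ) f g) (c : ℝ)
    (X : GroupLieAlgebra (𝓡 n) G) :
    lieDeriv X (fun x => c * f x) g = c * lieDeriv X f g := by
  rw [lieDeriv_mul mdifferentiableAt_const h, lieDeriv_const, mul_zero, add_zero]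

theorem lieDeriv_fun_sum {ι : Type*} (s : Finset ι) (c : ι → ℝ) {f : ι → G → ℝ} {g : G}
    (h : ∀ i ∈ s, MDifferentiableAt (𝓡 n) 𝓘(ℝ, ℝ) (f i) g) (X : GroupLieAlgebra (𝓡 n) G) :
    lieDeriv X (fun x => ∑ i ∈ s, c i * f i x) g = ∑ i ∈ s, c i * lieDeriv X (f i) g := by
  classical
  suffices H : MDifferentiableAt (𝓡 n) 𝓘(ℝ, ℝ) (fun x => ∑ i ∈ s, c i * f i x) g ∧
      lieDeriv X (fun x => ∑ i ∈ s, c i * f i x) g = ∑ i ∈ s, c i * lieDeriv X (f i) g from H.2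
  induction s using Finset.induction_on with
  | empty =>
    simp only [Finset.sum_empty]
    exact ⟨mdifferentiableAt_const, lieDeriv_const _ _ _⟩
  | insert i s hi ih =>
    simp only [Finset.sum_insert hi]
    have h₁ := h i (Finset.mem_insert_self i s)
    have h₂ := ih fun j hj => h j (Finset.mem_insert_of_mem hj)
    have h₃ : MDifferentiableAt (𝓡 n) 𝓘(ℝ, ℝ) (fun x => c i * f i x) g :=
      MDifferentiableAt.mul mdifferentiableAt_const h₁
    exact ⟨h₃.add h₂.1, by rw [lieDeriv_add h₃ h₂.1, lieDeriv_const_mul h₁, h₂.2]⟩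

variable [LieGroup (𝓡 n) ∞ G]

theorem lieDeriv_eq_coordDeriv {f : G → ℝ} {g : G} (hf : MDifferentiableAt (𝓡 n) 𝓘(ℝ, ℝ) f g)
    (X : GroupLieAlgebra (𝓡 n) G) :
    lieDeriv X f g = coordDeriv (𝓡 n) 𝓘(ℝ, ℝ) (fun k => f (g * k)) 1 X :=
  (coordDeriv_comp (mul_one g) hf (mdifferentiable_mul_left g 1) X).symm

/-- Writing the derivative as that of `k ↦ f (g * k)` at `k = 1` fixes the base point and the
vector; `g` is then a mere parameter, and only one order of smoothness is lost. -/
theorem contMDiff_lieDeriv {r s : ℕ∞} (hrs : r + 1 ≤ s) {f : G → ℝ}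
    (hf : ContMDiff (𝓡 n) 𝓘(ℝ, ℝ) s f) (X : GroupLieAlgebra (𝓡 n) G) :
    ContMDiff (𝓡 n) 𝓘(ℝ, ℝ) r (lieDeriv X f) := by
  have hrs' : (r : WithTop ℕ∞) + 1 ≤ s := by exact_mod_cast hrs
  have hs : (s : WithTop ℕ∞) ≠ 0 := by
    rintro h
    rw [h] at hrs'
    simp at hrs'
  have hfd := hf.mdifferentiable hs
  intro g₀
  have hF : ContMDiffAt ((𝓡 n).prod (𝓡 n)) 𝓘(ℝ, ℝ) s
      (Function.uncurry fun g x : G => f (g * x)) (g₀, 1) := by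
    have h : ContMDiff ((𝓡 n).prod (𝓡 n)) (𝓡 n) s fun p : G × G => p.1 * p.2 :=
      (contMDiff_mul (𝓡 n) ∞).of_le (WithTop.coe_le_coe.mpr le_top)
    exact (hf.comp h).contMDiffAt
  let v : EuclideanSpace ℝ (Fin n) := X
  have h := ContMDiffAt.mfderiv_apply (m := r) (fun g x : G => f (g * x)) (fun _ => 1) id
    (fun _ => v) hF contMDiffAt_const contMDiffAt_id contMDiffAt_const hrs'
  refine h.congr_of_eventuallyEq (Eventually.of_forall fun g => ?_)
  have e := inTangentCoordinates_eq_mfderiv_comp (I := 𝓡 n) (I' := 𝓘(ℝ, ℝ)) (N := G)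
    (f := fun _ => (1 : G)) (g := fun g : G => f (g * 1))
    (ϕ := fun g => mfderiv (𝓡 n) 𝓘(ℝ, ℝ) (fun x : G => f (g * x)) 1)
    (x₀ := g₀) (x := g) (mem_chart_source _ _) (by rw [chartAt_self_eq]; trivial)
  rw [lieDeriv_eq_coordDeriv (hfd g)]
  refine Eq.trans ?_ (congrArg (fun L : EuclideanSpace ℝ (Fin n) →L[ℝ] ℝ => L X) e).symm
  have e₂ := mfderivWithin_range_extChartAt_symm (I := 𝓡 n) (x := (1 : G))
  have e₁ : coordDeriv 𝓘(ℝ, ℝ) 𝓘(ℝ, ℝ) (extChartAt 𝓘(ℝ, ℝ) (f (g₀ * 1))) (f (g * 1))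
      = ContinuousLinearMap.id ℝ ℝ := by
    rw [coordDeriv_eq_fderiv, extChartAt_model_space_eq_id, PartialEquiv.refl_coe, fderiv_id]
  have := congrArg (fun L : ℝ →L[ℝ] ℝ =>
    L (coordDeriv (𝓡 n) 𝓘(ℝ, ℝ) (fun x : G => f (g * x)) 1 X)) e₁
  refine this.symm.trans ?_
  have := congrArg (fun L : EuclideanSpace ℝ (Fin n) →L[ℝ] EuclideanSpace ℝ (Fin n) =>
    coordDeriv 𝓘(ℝ, ℝ) 𝓘(ℝ, ℝ) (extChartAt 𝓘(ℝ, ℝ) (f (g₀ * 1))) (f (g * 1))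
      (coordDeriv (𝓡 n) 𝓘(ℝ, ℝ) (fun x : G => f (g * x)) 1 (L X))) e₂
  exact this.symm

end LieDerivative

/-! ### Haar measure and integration by parts on a compact group -/

section Haar

/-- A right translate of `μ` is again left-invariant, hence a multiple of `μ` by uniqueness; equal
total mass makes the factor `1`. -/
theorem isMulRightInvariant_of_compactSpace {K : Type*} [TopologicalSpace K] [Group K]
    [IsTopologicalGroup K] [CompactSpace K] [MeasurableSpace K] [BorelSpace K] (μ : Measure K)
    [μ.IsHaarMeasure] [IsProbabilityMeasure μ] : μ.IsMulRightInvariant := by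
  refine ⟨fun g => ?_⟩
  have hc : Continuous fun x : K => x * g := continuous_mul_const g
  have : IsProbabilityMeasure (μ.map (· * g)) :=
    Measure.isProbabilityMeasure_map hc.measurable.aemeasurable
  have h := Measure.isMulInvariant_eq_smul_of_compactSpace (μ.map (· * g)) μ
  have h₁ := congrArg (fun ν : Measure K => ν Set.univ) h
  simp only [measure_univ, Measure.smul_apply, ENNReal.smul_def, smul_eq_mul, mul_one] at h₁
  rw [h, ENNReal.coe_eq_one.1 h₁.symm, one_smul]

variable {p : ℕ} {K : Type*} [TopologicalSpace K] [Group K]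
  [ChartedSpace (EuclideanSpace ℝ (Fin p)) K] [LieGroup (𝓡 p) ∞ K] [CompactSpace K]
  [MeasurableSpace K] [BorelSpace K] (μ : Measure K) [μ.IsHaarMeasure] [IsProbabilityMeasure μ]

omit [LieGroup (𝓡 p) ∞ K] [Group K] [μ.IsHaarMeasure] in
theorem integrable_of_continuous_of_compactSpace {f : K → ℝ} (hf : Continuous f) :
    Integrable f μ := by
  obtain ⟨C, hC⟩ := isCompact_univ.exists_bound_of_continuousOn hf.continuousOn
  exact Integrable.of_bound hf.measurable.aestronglyMeasurable C
    (Eventually.of_forall fun x => hC x (Set.mem_univ x))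

/-- The integral of a derivative along a left-invariant vector field vanishes. -/
theorem integral_lieDeriv_eq_zero {f : K → ℝ} (hf : ContMDiff (𝓡 p) 𝓘(ℝ, ℝ) ∞ f)
    (X : GroupLieAlgebra (𝓡 p) K) : ∫ h, lieDeriv X f h ∂μ = 0 := by
  have : IsTopologicalGroup K := topologicalGroup_of_lieGroup (𝓡 p) ∞
  have := isMulRightInvariant_of_compactSpace μ
  have hfd := hf.mdifferentiable (by simp)
  set φ := extChartAt (𝓡 p) (1 : K) with hφ
  set x₀ := φ 1 with hx₀
  let v : EuclideanSpace ℝ (Fin p) := X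
  -- Any curve through `1` with velocity `X` will do; a straight line in the chart replaces the
  -- one-parameter subgroup.
  let γ : ℝ → K := fun t => φ.symm (x₀ + t • v)
  have hγ₀ : γ 0 = 1 := by
    simp only [γ, zero_smul, add_zero]
    exact extChartAt_to_inv 1
  have hline : ContDiff ℝ ∞ fun t : ℝ => x₀ + t • v := contDiff_const.add (contDiff_id.smul contDiff_const)
  have hopen : (fun t : ℝ => x₀ + t • v) ⁻¹' φ.target ∈ 𝓝 (0 : ℝ) := by
    refine hline.continuous.continuousAt.preimage_mem_nhds ?_
    simp only [zero_smul, add_zero]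
    exact extChartAt_target_mem_nhds 1
  obtain ⟨δ, hδ, hball⟩ := Metric.nhds_basis_closedBall.mem_iff.1 hopen
  have hγ : ∀ t ∈ Metric.closedBall (0 : ℝ) δ, ContMDiffAt 𝓘(ℝ, ℝ) (𝓡 p) ∞ γ t := fun t ht =>
    ContMDiffAt.comp (g := φ.symm) t ((contMDiffOn_extChartAt_symm 1).contMDiffAt
      ((isOpen_extChartAt_target 1).mem_nhds (hball ht))) hline.contMDiff.contMDiffAt
  have hF : ∀ t ∈ Metric.closedBall (0 : ℝ) δ, ∀ h : K,
      ContMDiffAt 𝓘(ℝ, ℝ) 𝓘(ℝ, ℝ) ∞ (fun s => f (h * γ s)) t := fun t ht h =>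
    ContMDiffAt.comp (g := fun k => f (h * k)) t
      (hf.comp (contMDiff_mul_left (a := h))).contMDiffAt (hγ t ht)
  have hF' : ContinuousOn (fun q : ℝ × K => deriv (fun s => f (q.2 * γ s)) q.1)
      (Metric.closedBall (0 : ℝ) δ ×ˢ Set.univ) := by
    rintro ⟨t, h⟩ ⟨ht, -⟩
    refine ContinuousAt.continuousWithinAt ?_
    have hu : ContMDiffAt ((𝓘(ℝ, ℝ).prod (𝓡 p)).prod 𝓘(ℝ, ℝ)) 𝓘(ℝ, ℝ) ∞
        (Function.uncurry fun (q : ℝ × K) (s : ℝ) => f (q.2 * γ s)) ((t, h), t) := by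
      have h₁ : ContMDiffAt ((𝓘(ℝ, ℝ).prod (𝓡 p)).prod 𝓘(ℝ, ℝ)) (𝓡 p) ∞
          (fun z : (ℝ × K) × ℝ => z.1.2) ((t, h), t) := (contMDiff_snd.comp contMDiff_fst).contMDiffAt
      have h₂ : ContMDiffAt ((𝓘(ℝ, ℝ).prod (𝓡 p)).prod 𝓘(ℝ, ℝ)) (𝓡 p) ∞
          (fun z : (ℝ × K) × ℝ => γ z.2) ((t, h), t) :=
        ContMDiffAt.comp (g := γ) ((t, h), t) (hγ t ht) contMDiffAt_snd
      exact ContMDiffAt.comp (g := f) ((t, h), t) hf.contMDiffAt (h₁.mul h₂)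
    have := ContMDiffAt.mfderiv_apply (m := ∞) (fun (q : ℝ × K) (s : ℝ) => f (q.2 * γ s))
      (fun q => q.1) id (fun _ => (1 : ℝ)) hu contMDiffAt_fst contMDiffAt_id contMDiffAt_const le_rfl
    refine (this.continuousAt).congr (Eventually.of_forall fun q => ?_)
    have e := inTangentCoordinates_model_space (I := 𝓘(ℝ, ℝ)) (I' := 𝓘(ℝ, ℝ)) (fun q : ℝ × K => q.1)
      (fun q => f (q.2 * γ q.1))
      (fun q => coordDeriv 𝓘(ℝ, ℝ) 𝓘(ℝ, ℝ) (fun s => f (q.2 * γ s)) q.1) (t, h)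
    refine (congrArg (fun L : ℝ →L[ℝ] ℝ => L 1) (congrFun e q)).trans ?_
    exact congrArg (fun L : ℝ →L[ℝ] ℝ => L 1)
      (coordDeriv_eq_fderiv (fun s => f (q.2 * γ s)) q.1)
  obtain ⟨C, hC⟩ := ((isCompact_closedBall (0 : ℝ) δ).prod isCompact_univ).exists_bound_of_continuousOn hF'
  have hcont : ∀ t, Continuous fun h => f (h * γ t) := fun t =>
    hf.continuous.comp (continuous_mul_const _)
  have hderiv : ∀ t ∈ Metric.closedBall (0 : ℝ) δ, ∀ h : K,
      HasDerivAt (fun s => f (h * γ s)) (deriv (fun s => f (h * γ s)) t) t := fun t ht h =>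
    (mdifferentiableAt_iff_differentiableAt.1
      ((hF t ht h).mdifferentiableAt (by simp))).hasDerivAt
  have h₀ : (0 : ℝ) ∈ Metric.closedBall (0 : ℝ) δ := Metric.mem_closedBall_self hδ.le
  have hF'₀ : Continuous fun h => deriv (fun s => f (h * γ s)) 0 := by
    have := hF'.comp_continuous (Continuous.prodMk_right (0 : ℝ)) fun h => ⟨h₀, Set.mem_univ h⟩
    exact this
  -- Right invariance makes `∫ f (h * γ t)` constant in `t`. Differentiating at `0` under the
  -- integral, with the bound `C` from compactness, gives the claim.
  have key := hasDerivAt_integral_of_dominated_loc_of_deriv_le (μ := μ)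
    (F := fun t h => f (h * γ t)) (F' := fun t h => deriv (fun s => f (h * γ s)) t)
    (bound := fun _ => C) (Metric.closedBall_mem_nhds (0 : ℝ) hδ)
    (Eventually.of_forall fun t => (hcont t).measurable.aestronglyMeasurable)
    (integrable_of_continuous_of_compactSpace μ (hcont 0)) hF'₀.measurable.aestronglyMeasurable
    (Eventually.of_forall fun h t ht => hC (t, h) ⟨ht, Set.mem_univ h⟩) (integrable_const C)
    (Eventually.of_forall fun h t ht => hderiv t ht h)
  have hconst : (fun t => ∫ h, f (h * γ t) ∂μ) = fun _ => ∫ h, f h ∂μ := by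
    ext t
    exact integral_mul_right_eq_self f (γ t)
  have hzero := key.2
  rw [hconst] at hzero
  rw [← hzero.unique (hasDerivAt_const 0 _)]
  refine integral_congr_ae (Eventually.of_forall fun h => ?_)
  have hγd : coordDeriv 𝓘(ℝ, ℝ) (𝓡 p) γ 0 1 = v := by
    have hsd : MDifferentiableAt 𝓘(ℝ, EuclideanSpace ℝ (Fin p)) (𝓡 p) φ.symm x₀ :=
      ((contMDiffOn_extChartAt_symm (n := ∞) 1).contMDiffAt
        (extChartAt_target_mem_nhds 1)).mdifferentiableAt (by simp)
    refine (coordDeriv_comp (I := 𝓘(ℝ, ℝ)) (f := fun t : ℝ => x₀ + t • v) (x := 0) (y := x₀) (by simp)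
      hsd (hline.contMDiff.mdifferentiable (by simp) 0) 1).trans ?_
    rw [coordDeriv_eq_fderiv]
    have hl : HasFDerivAt (fun t : ℝ => x₀ + t • v) ((ContinuousLinearMap.id ℝ ℝ).smulRight v) 0 :=
      ((hasFDerivAt_id (𝕜 := ℝ) (0 : ℝ)).smul_const v).const_add x₀
    rw [hl.fderiv]
    simp only [ContinuousLinearMap.smulRight_apply, ContinuousLinearMap.id_apply, one_smul]
    have e := mfderivWithin_range_extChartAt_symm (I := 𝓡 p) (x := (1 : K))
    rw [ModelWithCorners.range_eq_univ, mfderivWithin_univ] at e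
    exact congrArg (fun L : EuclideanSpace ℝ (Fin p) →L[ℝ] EuclideanSpace ℝ (Fin p) => L v) e
  have := coordDeriv_comp (I := 𝓘(ℝ, ℝ)) (f := γ) (g := fun k => f (h * k)) (x := (0 : ℝ)) hγ₀
    ((hf.comp (contMDiff_mul_left (a := h))).mdifferentiable (by simp) 1)
    ((hγ 0 h₀).mdifferentiableAt (by simp)) 1
  rw [hγd, coordDeriv_eq_fderiv] at this
  rw [lieDeriv_eq_coordDeriv (hfd h)]
  exact this.symm

theorem integral_lieDeriv_mul {u v : K → ℝ} (hu : ContMDiff (𝓡 p) 𝓘(ℝ, ℝ) ∞ u)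
    (hv : ContMDiff (𝓡 p) 𝓘(ℝ, ℝ) ∞ v) (X : GroupLieAlgebra (𝓡 p) K) :
    ∫ h, lieDeriv X u h * v h ∂μ = -∫ h, u h * lieDeriv X v h ∂μ := by
  have hXu : ContMDiff (𝓡 p) 𝓘(ℝ, ℝ) ∞ (lieDeriv X u) := contMDiff_lieDeriv le_rfl hu X
  have hXv : ContMDiff (𝓡 p) 𝓘(ℝ, ℝ) ∞ (lieDeriv X v) := contMDiff_lieDeriv le_rfl hv X
  have h := integral_lieDeriv_eq_zero μ (hu.mul hv) X
  have e : lieDeriv X (fun x => u x * v x) = fun x => u x * lieDeriv X v x + lieDeriv X u x * v x := by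
    ext x
    rw [lieDeriv_mul (hu.mdifferentiable (by simp) x) (hv.mdifferentiable (by simp) x),
      mul_comm (v x)]
  have h' : ∫ x, (u x * lieDeriv X v x + lieDeriv X u x * v x) ∂μ = 0 := by
    rw [← e]
    exact h
  have i₁ : Integrable (fun x => u x * lieDeriv X v x) μ :=
    integrable_of_continuous_of_compactSpace μ (hu.continuous.mul hXv.continuous)
  have i₂ : Integrable (fun x => lieDeriv X u x * v x) μ :=
    integrable_of_continuous_of_compactSpace μ (hXu.continuous.mul hv.continuous)
  rw [integral_add i₁ i₂] at h'
  linarith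

/-- A sum of squares of left-invariant vector fields is symmetric. -/
theorem integral_sumSquares_mul {N : ℕ} (A : Fin N → GroupLieAlgebra (𝓡 p) K) {u v : K → ℝ}
    (hu : ContMDiff (𝓡 p) 𝓘(ℝ, ℝ) ∞ u) (hv : ContMDiff (𝓡 p) 𝓘(ℝ, ℝ) ∞ v) :
    ∫ h, sumSquares A u h * v h ∂μ = ∫ h, u h * sumSquares A v h ∂μ := by
  have hL : ∀ (X : GroupLieAlgebra (𝓡 p) K) {w : K → ℝ}, ContMDiff (𝓡 p) 𝓘(ℝ, ℝ) ∞ w →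
      ContMDiff (𝓡 p) 𝓘(ℝ, ℝ) ∞ (lieDeriv X w) := fun X _ hw => contMDiff_lieDeriv le_rfl hw X
  have i₁ : ∀ k, Integrable (fun x => lieDeriv (A k) (lieDeriv (A k) u) x * v x) μ := fun k =>
    integrable_of_continuous_of_compactSpace μ
      ((hL (A k) (hL (A k) hu)).continuous.mul hv.continuous)
  have i₂ : ∀ k, Integrable (fun x => u x * lieDeriv (A k) (lieDeriv (A k) v) x) μ := fun k =>
    integrable_of_continuous_of_compactSpace μ
      (hu.continuous.mul (hL (A k) (hL (A k) hv)).continuous)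
  simp only [sumSquares, Finset.sum_mul, Finset.mul_sum]
  rw [integral_finsetSum _ fun k _ => i₁ k, integral_finsetSum _ fun k _ => i₂ k]
  refine Finset.sum_congr rfl fun k _ => ?_
  rw [integral_lieDeriv_mul μ (hL _ hu) hv, integral_lieDeriv_mul μ hu (hL _ hv), neg_neg]

end Haar

/-! ### Functions killed by all left-invariant derivatives -/

section LocallyConstant

variable {p : ℕ} {K : Type*} [TopologicalSpace K] [Group K]
  [ChartedSpace (EuclideanSpace ℝ (Fin p)) K] [LieGroup (𝓡 p) ∞ K]

/-- Left-invariant fields span every tangent space: translating `v` back by `h⁻¹` gives the Lie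
algebra element whose field takes the value `v` at `h`. -/
theorem coordDeriv_eq_zero_of_lieDeriv_eq_zero {f : K → ℝ} (hf : MDifferentiable (𝓡 p) 𝓘(ℝ, ℝ) f)
    {h : K} (h₀ : ∀ X : GroupLieAlgebra (𝓡 p) K, lieDeriv X f h = 0) (v : EuclideanSpace ℝ (Fin p)) :
    coordDeriv (𝓡 p) 𝓘(ℝ, ℝ) f h v = 0 := by
  have e := coordDeriv_comp (I := 𝓡 p) (f := fun k : K => h⁻¹ * k) (g := fun k => f (h * k)) (x := h)
    (inv_mul_cancel h) ((hf.comp (mdifferentiable_mul_left h)) 1) (mdifferentiable_mul_left h⁻¹ h) v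
  simp only [mul_inv_cancel_left] at e
  rw [e]
  exact (lieDeriv_eq_coordDeriv (hf h) (coordDeriv (𝓡 p) (𝓡 p) (fun k : K => h⁻¹ * k) h v)).symm.trans
    (h₀ _)

theorem eq_of_lieDeriv_eq_zero [PreconnectedSpace K] {f : K → ℝ}
    (hf : MDifferentiable (𝓡 p) 𝓘(ℝ, ℝ) f)
    (h₀ : ∀ (X : GroupLieAlgebra (𝓡 p) K) (h : K), lieDeriv X f h = 0) (x y : K) : f x = f y := by
  have hloc : IsLocallyConstant f := by
    rw [IsLocallyConstant.iff_eventually_eq]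
    intro k
    set φ := extChartAt (𝓡 p) k
    obtain ⟨δ, hδ, hball⟩ := Metric.mem_nhds_iff.1 (extChartAt_target_mem_nhds (I := 𝓡 p) k)
    have hsd : ∀ z ∈ Metric.ball (φ k) δ,
        MDifferentiableAt 𝓘(ℝ, EuclideanSpace ℝ (Fin p)) (𝓡 p) φ.symm z := fun z hz =>
      ((contMDiffOn_extChartAt_symm (n := ∞) k).contMDiffAt
        ((isOpen_extChartAt_target k).mem_nhds (hball hz))).mdifferentiableAt (by simp)
    have hconst : ∀ z ∈ Metric.ball (φ k) δ, f (φ.symm z) = f (φ.symm (φ k)) := fun z hz => by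
      refine Metric.isOpen_ball.is_const_of_fderiv_eq_zero (𝕜 := ℝ) (f := fun z => f (φ.symm z))
        (convex_ball (φ k) δ).isPreconnected (fun w hw => ?_) (fun w hw => ?_) hz
        (Metric.mem_ball_self hδ)
      · exact (mdifferentiableAt_iff_differentiableAt.1
          ((hf (φ.symm w)).comp w (hsd w hw))).differentiableWithinAt
      · ext v
        rw [← coordDeriv_eq_fderiv, coordDeriv_comp rfl (hf (φ.symm w)) (hsd w hw),
          coordDeriv_eq_zero_of_lieDeriv_eq_zero hf fun X => h₀ X _]
        rfl
    have hcont : ContinuousAt φ k := continuousAt_extChartAt k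
    filter_upwards [hcont.preimage_mem_nhds (Metric.ball_mem_nhds (φ k) hδ),
      extChartAt_source_mem_nhds (I := 𝓡 p) k] with z hz hz'
    have := hconst (φ z) hz
    rwa [φ.left_inv hz', φ.left_inv (mem_extChartAt_source k)] at this
  exact hloc.apply_eq_of_preconnectedSpace x y

end LocallyConstant

/-! ### `Ad` acts by Lie algebra automorphisms -/

section AdDerivative

variable {n : ℕ} {G : Type*} [TopologicalSpace G] [Group G]
  [ChartedSpace (EuclideanSpace ℝ (Fin n)) G] [LieGroup (𝓡 n) ∞ G]

theorem Ad_mul_inv_apply (g : G) (X : GroupLieAlgebra (𝓡 n) G) :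
    Ad n g (Ad n g⁻¹ X) = X := by
  rw [← Ad_mul, mul_inv_cancel, Ad_one]

theorem coordDeriv_clm_conj_one {F : Type*} [NormedAddCommGroup F] [NormedSpace ℝ F]
    (L : EuclideanSpace ℝ (Fin n) →L[ℝ] F) (X Y : GroupLieAlgebra (𝓡 n) G) :
    coordDeriv (𝓡 n) 𝓘(ℝ, F)
      (fun g : G => L (coordDeriv (𝓡 n) (𝓡 n) (fun x : G => g * x * g⁻¹) 1 Y)) 1 X =
      L (⁅X, Y⁆ : GroupLieAlgebra (𝓡 n) G) := by
  refine (coordDeriv_comp (I := 𝓡 n) (I' := 𝓘(ℝ, EuclideanSpace ℝ (Fin n))) (I'' := 𝓘(ℝ, F))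
    (f := fun g : G => coordDeriv (𝓡 n) (𝓡 n) (fun x : G => g * x * g⁻¹) 1 Y) (g := L) (x := 1) rfl
    L.differentiableAt.mdifferentiableAt
    ((contMDiff_coordDeriv_conj (G := G) Y).mdifferentiable (by simp) 1) X).trans ?_
  rw [coordDeriv_eq_fderiv, L.fderiv]
  exact congrArg L (coordDeriv_conj_one_eq_lie X Y)

/-- The adjoint action is by automorphisms of the Lie algebra. -/
theorem Ad_lie (g : G) (X Y : GroupLieAlgebra (𝓡 n) G) :
    Ad n g ⁅X, Y⁆ = ⁅Ad n g X, Ad n g Y⁆ := by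
  -- Differentiate `Ad g (Ad k Y) = Ad (g * k * g⁻¹) (Ad g Y)` in `k` at `1` along `X`.
  refine (coordDeriv_clm_conj_one (coordDeriv (𝓡 n) (𝓡 n) (fun x : G => g * x * g⁻¹) 1)
    X Y).symm.trans ?_
  refine Eq.trans ?_ (coordDeriv_conj_one_eq_lie (Ad n g X) (Ad n g Y))
  refine Eq.trans ?_ (coordDeriv_comp (I := 𝓡 n) (I' := 𝓡 n) (I'' := 𝓘(ℝ, EuclideanSpace ℝ (Fin n)))
    (f := fun k : G => g * k * g⁻¹)
    (g := fun k : G => coordDeriv (𝓡 n) (𝓡 n) (fun x : G => k * x * k⁻¹) 1 (Ad n g Y)) (x := 1) (y := 1)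
    (by simp) ((contMDiff_coordDeriv_conj (G := G) (Ad n g Y)).mdifferentiable (by simp) 1)
    (mdifferentiable_conj g 1) X)
  congr 2
  ext1 k
  refine (Ad_mul g k Y).symm.trans ?_
  refine Eq.trans ?_ (Ad_mul (g * k * g⁻¹) g Y)
  rw [inv_mul_cancel_right]

end AdDerivative

/-! ### Infinitesimal consequences of invariance under `H` -/

section Subgroup

variable {n p : ℕ} {G : Type*} [TopologicalSpace G] [Group G]
  [ChartedSpace (EuclideanSpace ℝ (Fin n)) G] [LieGroup (𝓡 n) ∞ G]
  {H : Subgroup G} [ChartedSpace (EuclideanSpace ℝ (Fin p)) H] [LieGroup (𝓡 p) ∞ H]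

instance finiteDimensional_groupLieAlgebra : FiniteDimensional ℝ (GroupLieAlgebra (𝓡 n) G) :=
  inferInstanceAs (FiniteDimensional ℝ (EuclideanSpace ℝ (Fin n)))

omit [LieGroup (𝓡 p) ∞ H] in
theorem contMDiff_linear_Ad (hH : ContMDiff (𝓡 p) (𝓡 n) ∞ (Subtype.val : H → G))
    (l : GroupLieAlgebra (𝓡 n) G →ₗ[ℝ] ℝ) (Y : GroupLieAlgebra (𝓡 n) G) :
    ContMDiff (𝓡 p) 𝓘(ℝ, ℝ) ∞ fun h : H => l (Ad n (h : G) Y) := by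
  let l' : EuclideanSpace ℝ (Fin n) →ₗ[ℝ] ℝ := l
  have hl : ContMDiff 𝓘(ℝ, EuclideanSpace ℝ (Fin n)) 𝓘(ℝ, ℝ) ∞ l' :=
    (LinearMap.toContinuousLinearMap l').contDiff.contMDiff
  exact hl.comp ((contMDiff_coordDeriv_conj (G := G) Y).comp hH)

/-- Differentiate `l (Ad h (Ad k Y))` at `k = 1`. Differentiation merely replaces `Y` by a bracket,
so functions of this kind are closed under left-invariant derivatives. -/
theorem lieDeriv_linear_Ad (hH : ContMDiff (𝓡 p) (𝓡 n) ∞ (Subtype.val : H → G))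
    (l : GroupLieAlgebra (𝓡 n) G →ₗ[ℝ] ℝ) (A : GroupLieAlgebra (𝓡 p) H)
    (Y : GroupLieAlgebra (𝓡 n) G) (h : H) :
    lieDeriv A (fun k : H => l (Ad n (k : G) Y)) h = l (Ad n (h : G) ⁅inclLie n p H A, Y⁆) := by
  rw [lieDeriv_eq_coordDeriv ((contMDiff_linear_Ad hH l Y).mdifferentiable (by simp) h)]
  let l' : EuclideanSpace ℝ (Fin n) →ₗ[ℝ] ℝ := l ∘ₗ Ad n (h : G)
  let L : EuclideanSpace ℝ (Fin n) →L[ℝ] ℝ := LinearMap.toContinuousLinearMap l'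
  have hL : ContMDiff 𝓘(ℝ, EuclideanSpace ℝ (Fin n)) 𝓘(ℝ, ℝ) ∞ L := L.contDiff.contMDiff
  refine Eq.trans ?_ (coordDeriv_clm_conj_one L (inclLie n p H A) Y)
  refine Eq.trans ?_ (coordDeriv_comp (I := 𝓡 p) (I' := 𝓡 n) (I'' := 𝓘(ℝ, ℝ))
    (f := (Subtype.val : H → G))
    (g := fun g : G => L (coordDeriv (𝓡 n) (𝓡 n) (fun x : G => g * x * g⁻¹) 1 Y)) (x := 1) (y := 1) rfl
    ((hL.comp (contMDiff_coordDeriv_conj (G := G) Y)).mdifferentiable (by simp) 1)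
    (hH.mdifferentiable (by simp) 1) A)
  congr 2
  ext1 k
  exact congrArg l (Ad_mul (h : G) (k : G) Y)

/-- The adjoint action of `H` preserves its Lie algebra. -/
theorem Ad_inclLie (hH : ContMDiff (𝓡 p) (𝓡 n) ∞ (Subtype.val : H → G)) (h : H)
    (A : GroupLieAlgebra (𝓡 p) H) :
    Ad n (h : G) (inclLie n p H A) = inclLie n p H (Ad p h A) := by
  have hd := hH.mdifferentiable (by simp)
  have e₁ := coordDeriv_comp (I := 𝓡 p) (I' := 𝓡 n) (I'' := 𝓡 n) (f := (Subtype.val : H → G))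
    (g := fun x : G => (h : G) * x * (h : G)⁻¹) (x := 1) (y := 1) rfl (mdifferentiable_conj (h : G) 1)
    (hd 1) A
  have e₂ := coordDeriv_comp (I := 𝓡 p) (I' := 𝓡 p) (I'' := 𝓡 n) (f := fun x : H => h * x * h⁻¹)
    (g := (Subtype.val : H → G)) (x := 1) (y := 1) (by simp) (hd 1) (mdifferentiable_conj h 1) A
  exact e₁.symm.trans e₂

/-- For a functional `l` annihilating `V`, the function `l (Ad k X)` vanishes identically on `H`,
and so does its derivative at `1`; such functionals cut out `V`. -/
theorem lie_mem_of_isAdInvariant (hH : ContMDiff (𝓡 p) (𝓡 n) ∞ (Subtype.val : H → G))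
    {V : Submodule ℝ (GroupLieAlgebra (𝓡 n) G)} (hV : IsAdInvariant H V)
    (A : GroupLieAlgebra (𝓡 p) H) {X : GroupLieAlgebra (𝓡 n) G} (hX : X ∈ V) :
    ⁅inclLie n p H A, X⁆ ∈ V := by
  rw [← Subspace.forall_mem_dualAnnihilator_apply_eq_zero_iff V]
  intro l hl
  rw [Submodule.mem_dualAnnihilator] at hl
  have e := lieDeriv_linear_Ad hH l A X 1
  have hz : (fun k : H => l (Ad n (k : G) X)) = fun _ => 0 := funext fun k => hl _ (hV k k.2 X hX)
  rw [hz, lieDeriv_const, Subgroup.coe_one, Ad_one] at e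
  exact e.symm

/-- The adjoint representation of the Lie algebra of `H` is skew for an invariant inner product. -/
theorem bilin_lie_left (hH : ContMDiff (𝓡 p) (𝓡 n) ∞ (Subtype.val : H → G))
    {B : LinearMap.BilinForm ℝ (GroupLieAlgebra (𝓡 n) G)} (hB : IsInvariantInnerProduct H B)
    (A : GroupLieAlgebra (𝓡 p) H) (X Y : GroupLieAlgebra (𝓡 n) G) :
    B ⁅inclLie n p H A, X⁆ Y = -B X ⁅inclLie n p H A, Y⁆ := by
  -- A basis turns the constant function `B (Ad h X) (Ad h Y)` into a sum of products of scalar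
  -- functions, to which the product rule applies.
  let b := Module.finBasis ℝ (GroupLieAlgebra (𝓡 n) G)
  have hexp : ∀ U W, B U W = ∑ i, 1 * (b.coord i U * B (b i) W) := fun U W =>
    (congrArg (fun Z => B Z W) (b.sum_repr U)).symm.trans (by
      simp only [map_sum, map_smul, LinearMap.sum_apply, LinearMap.smul_apply, smul_eq_mul, one_mul,
        Module.Basis.coord_apply])
  have hd₁ : ∀ (l : GroupLieAlgebra (𝓡 n) G →ₗ[ℝ] ℝ) (Z : GroupLieAlgebra (𝓡 n) G),
      MDifferentiableAt (𝓡 p) 𝓘(ℝ, ℝ) (fun h : H => l (Ad n (h : G) Z)) 1 := fun l Z =>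
    (contMDiff_linear_Ad hH l Z).mdifferentiable (by simp) 1
  have hconst : (fun h : H => ∑ i, 1 * (b.coord i (Ad n (h : G) X) * B (b i) (Ad n (h : G) Y)))
      = fun _ => B X Y := funext fun h => by rw [← hexp, hB.invariant h h.2]
  have key := lieDeriv_fun_sum Finset.univ (fun _ => 1)
    (f := fun i (h : H) => b.coord i (Ad n (h : G) X) * B (b i) (Ad n (h : G) Y)) (g := 1)
    (fun i _ => (hd₁ (b.coord i) X).mul (hd₁ (B (b i)) Y)) A
  rw [hconst, lieDeriv_const] at key
  simp only [lieDeriv_mul (hd₁ (b.coord _) X) (hd₁ (B (b _)) Y), lieDeriv_linear_Ad hH,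
    Subgroup.coe_one, Ad_one, mul_add, Finset.sum_add_distrib] at key
  rw [hexp ⁅inclLie n p H A, X⁆ Y, hexp X, eq_neg_iff_add_eq_zero, add_comm, key]
  congr 1
  refine Finset.sum_congr rfl fun i _ => ?_
  ring

/-- Each `l (Ad k Y)` has zero left-invariant derivatives, hence is constant on the connected `H`,
and functionals separate points. -/
theorem Ad_eq_self_of_lie_eq_zero [PreconnectedSpace H]
    (hH : ContMDiff (𝓡 p) (𝓡 n) ∞ (Subtype.val : H → G)) {Y : GroupLieAlgebra (𝓡 n) G}
    (hY : ∀ A, ⁅inclLie n p H A, Y⁆ = 0) {h : G} (hh : h ∈ H) : Ad n h Y = Y := by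
  rw [← sub_eq_zero, ← Module.forall_dual_apply_eq_zero_iff ℝ]
  intro l
  rw [map_sub, sub_eq_zero]
  have := eq_of_lieDeriv_eq_zero ((contMDiff_linear_Ad hH l Y).mdifferentiable (by simp))
    (fun A k => by rw [lieDeriv_linear_Ad hH, hY A, map_zero, map_zero]) ⟨h, hh⟩ 1
  rwa [Subgroup.coe_one, Ad_one] at this

omit [LieGroup (𝓡 p) ∞ H] in
-- By the Jacobi identity the centraliser of `Y` is a Lie subalgebra, so it contains everything
-- generated by the `A k`.
theorem lie_eq_zero_of_isLieGenerating {N : ℕ} {A : Fin N → GroupLieAlgebra (𝓡 p) H}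
    (hA : IsLieGenerating (n := n) H A) {Y : GroupLieAlgebra (𝓡 n) G}
    (hY : ∀ k, ⁅inclLie n p H (A k), Y⁆ = 0) (A' : GroupLieAlgebra (𝓡 p) H) :
    ⁅inclLie n p H A', Y⁆ = 0 := by
  let C : LieSubalgebra ℝ (GroupLieAlgebra (𝓡 n) G) :=
    { carrier := {X | ⁅X, Y⁆ = 0}
      add_mem' := fun {X X'} h h' => by
        change ⁅X, Y⁆ = 0 at h
        change ⁅X', Y⁆ = 0 at h'
        change ⁅X + X', Y⁆ = 0
        rw [add_lie, h, h', add_zero]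
      zero_mem' := zero_lie Y
      smul_mem' := fun c X h => by
        change ⁅X, Y⁆ = 0 at h
        change ⁅c • X, Y⁆ = 0
        rw [smul_lie, h, smul_zero]
      lie_mem' := fun {X X'} h h' => by
        change ⁅⁅X, X'⁆, Y⁆ = 0
        change ⁅X, Y⁆ = 0 at h
        change ⁅X', Y⁆ = 0 at h'
        rw [lie_lie, h, h', lie_zero, lie_zero, sub_zero] }
  have hle : LieSubalgebra.lieSpan ℝ (GroupLieAlgebra (𝓡 n) G)
      (Set.range fun k => inclLie n p H (A k)) ≤ C := by
    rw [LieSubalgebra.lieSpan_le]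
    rintro _ ⟨k, rfl⟩
    exact hY k
  exact hle ((hA _).2 ⟨A', rfl⟩)

end Subgroup

/-! ### Basis independence of the trace of a form -/

section LinearAlgebra

variable {E : Type*} [AddCommGroup E] [Module ℝ E] {B T : LinearMap.BilinForm ℝ E}

/-- The trace of a bilinear form does not depend on the orthonormal basis. -/
theorem sum_bilin_eq_of_orthonormal {d : ℕ} {e f : Fin d → E} (hB : ∀ X Y, B X Y = B Y X)
    (he : ∀ i j, B (e i) (e j) = if i = j then 1 else 0)
    (hf : ∀ i j, B (f i) (f j) = if i = j then 1 else 0)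
    (hef : Submodule.span ℝ (Set.range e) = Submodule.span ℝ (Set.range f)) :
    ∑ k, T (f k) (f k) = ∑ k, T (e k) (e k) := by
  have hfe : ∀ k, f k = ∑ i, B (f k) (e i) • e i := fun k =>
    eq_sum_of_orthonormal he (hef ▸ Submodule.subset_span ⟨k, rfl⟩)
  have hT : ∀ k, T (f k) (f k) = ∑ i, ∑ j, B (f k) (e i) * B (f k) (e j) * T (e i) (e j) := fun k => by
    conv_lhs => rw [hfe k]
    simp only [map_sum, map_smul, LinearMap.sum_apply, LinearMap.smul_apply, smul_eq_mul]
    rw [Finset.sum_comm]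
    simp only [Finset.mul_sum]
    refine Finset.sum_congr rfl fun i _ => Finset.sum_congr rfl fun j _ => ?_
    ring
  have hparseval : ∀ i j, ∑ k, B (f k) (e i) * B (f k) (e j) = if i = j then 1 else 0 := fun i j => by
    rw [← he i j, bilin_eq_sum_of_orthonormal hf (X := e i) (hef ▸ Submodule.subset_span ⟨i, rfl⟩)]
    simp only [hB (e i)]
  simp only [hT]
  rw [Finset.sum_comm]
  refine Finset.sum_congr rfl fun i _ => ?_
  rw [Finset.sum_comm]
  simp only [← Finset.sum_mul, hparseval, ite_mul, one_mul, zero_mul, Finset.sum_ite_eq,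
    Finset.mem_univ, if_true]

end LinearAlgebra

/-! ### Linearity of the Casimir operator -/

section Casimir

variable {n : ℕ} {G : Type*} [TopologicalSpace G] [Group G]
  [ChartedSpace (EuclideanSpace ℝ (Fin n)) G] [LieGroup (𝓡 n) ∞ G]

/-- `casimir` as a linear map. -/
noncomputable def casimirLinear {N : ℕ} (A : Fin N → GroupLieAlgebra (𝓡 n) G) :
    GroupLieAlgebra (𝓡 n) G →ₗ[ℝ] GroupLieAlgebra (𝓡 n) G where
  toFun := casimir A
  map_add' X Y := by
    simp only [casimir, lie_add, Finset.sum_add_distrib, smul_add, neg_add]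
  map_smul' c X := by
    simp only [casimir, lie_smul, ← Finset.smul_sum, RingHom.id_apply, smul_neg]
    rw [smul_comm]

theorem casimirLinear_apply {N : ℕ} (A : Fin N → GroupLieAlgebra (𝓡 n) G)
    (X : GroupLieAlgebra (𝓡 n) G) : casimirLinear A X = casimir A X := rfl

end Casimir

/-! ### Positivity and invariance of the Casimir operator; correlations of matrix coefficients -/

section Subgroup

variable {n p : ℕ} {G : Type*} [TopologicalSpace G] [Group G]
  [ChartedSpace (EuclideanSpace ℝ (Fin n)) G] [LieGroup (𝓡 n) ∞ G]
  {H : Subgroup G} [ChartedSpace (EuclideanSpace ℝ (Fin p)) H] [LieGroup (𝓡 p) ∞ H]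
  {B : LinearMap.BilinForm ℝ (GroupLieAlgebra (𝓡 n) G)}
  {N : ℕ} {A : Fin N → GroupLieAlgebra (𝓡 p) H}

/-- Skewness moves one bracket to the other side. Symmetry and nonnegativity of the Casimir form can
be read off. -/
theorem bilin_casimir (hH : ContMDiff (𝓡 p) (𝓡 n) ∞ (Subtype.val : H → G))
    (hB : IsInvariantInnerProduct H B) (X Y : GroupLieAlgebra (𝓡 n) G) :
    B (casimir (fun k => inclLie n p H (A k)) X) Y
      = (1 / 2) * ∑ k, B ⁅inclLie n p H (A k), X⁆ ⁅inclLie n p H (A k), Y⁆ := by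
  simp only [casimir, map_neg, map_smul, map_sum, LinearMap.neg_apply, LinearMap.smul_apply,
    LinearMap.sum_apply, smul_eq_mul]
  simp only [bilin_lie_left hH hB _ ⁅inclLie n p H (A _), X⁆ Y, Finset.sum_neg_distrib, mul_neg,
    neg_neg]

theorem casimir_mem_of_isAdInvariant (hH : ContMDiff (𝓡 p) (𝓡 n) ∞ (Subtype.val : H → G))
    {V : Submodule ℝ (GroupLieAlgebra (𝓡 n) G)} (hV : IsAdInvariant H V)
    {X : GroupLieAlgebra (𝓡 n) G} (hX : X ∈ V) :
    casimir (fun k => inclLie n p H (A k)) X ∈ V :=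
  V.neg_mem (V.smul_mem _ (V.sum_mem fun _ _ => lie_mem_of_isAdInvariant hH hV _
    (lie_mem_of_isAdInvariant hH hV _ hX)))

omit [LieGroup (𝓡 n) ∞ G] in
theorem bilin_self_nonneg (hB : IsInvariantInnerProduct H B) (X : GroupLieAlgebra (𝓡 n) G) :
    0 ≤ B X X := by
  rcases eq_or_ne X 0 with rfl | h
  · simp
  · exact (hB.pos X h).le

/-- The Casimir operator is positive definite off the fixed vectors. -/
theorem bilin_casimir_self_pos [PreconnectedSpace H]
    (hH : ContMDiff (𝓡 p) (𝓡 n) ∞ (Subtype.val : H → G))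
    (hB : IsInvariantInnerProduct H B) (hA : IsLieGenerating (n := n) H A)
    {X : GroupLieAlgebra (𝓡 n) G} (hX : ¬∀ h ∈ H, Ad n h X = X) :
    0 < B (casimir (fun k => inclLie n p H (A k)) X) X := by
  rw [bilin_casimir hH hB]
  have hnn : ∀ k, 0 ≤ B ⁅inclLie n p H (A k), X⁆ ⁅inclLie n p H (A k), X⁆ := fun k =>
    bilin_self_nonneg hB _
  refine mul_pos (by norm_num) ((Finset.sum_nonneg fun k _ => hnn k).lt_of_ne' fun h => hX ?_)
  have hk : ∀ k, ⁅inclLie n p H (A k), X⁆ = 0 := fun k => by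
    by_contra hne
    exact (hB.pos _ hne).ne' ((Finset.sum_eq_zero_iff_of_nonneg fun k _ => hnn k).1 h k
      (Finset.mem_univ k))
  exact fun h hh => Ad_eq_self_of_lie_eq_zero hH (lie_eq_zero_of_isLieGenerating hA hk) hh

/-- The matrix coefficients of the Casimir operator of an orthonormal basis of `𝔥` are invariant. -/
theorem bilin_casimir_Ad (hH : ContMDiff (𝓡 p) (𝓡 n) ∞ (Subtype.val : H → G))
    (hB : IsInvariantInnerProduct H B)
    (hA : IsOrthonormalBasisOf B (subLie n p H) fun k => inclLie n p H (A k)) (h : H)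
    (X Y : GroupLieAlgebra (𝓡 n) G) :
    B (casimir (fun k => inclLie n p H (A k)) (Ad n (h : G) X)) (Ad n (h : G) Y)
      = B (casimir (fun k => inclLie n p H (A k)) X) Y := by
  rw [bilin_casimir hH hB, bilin_casimir hH hB]
  congr 1
  -- Conjugating by `Ad h` replaces each `A k` by `Ad h⁻¹ (A k)`, another orthonormal basis of `𝔥`;
  -- the sum is the trace of the form `T` on `𝔥`, hence unchanged.
  have hAd : ∀ k Z, ⁅inclLie n p H (A k), Ad n (h : G) Z⁆
      = Ad n (h : G) ⁅inclLie n p H (Ad p h⁻¹ (A k)), Z⁆ := fun k Z => by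
    rw [Ad_lie, Ad_inclLie hH, Ad_mul_inv_apply]
  simp only [hAd, hB.invariant _ h.2]
  let T : LinearMap.BilinForm ℝ (GroupLieAlgebra (𝓡 n) G) :=
    LinearMap.mk₂ ℝ (fun U W => B ⁅U, X⁆ ⁅W, Y⁆) (fun _ _ _ => by simp) (fun _ _ _ => by simp)
      (fun _ _ _ => by simp) (fun _ _ _ => by simp)
  have horth : ∀ i j, B (inclLie n p H (Ad p h⁻¹ (A i))) (inclLie n p H (Ad p h⁻¹ (A j)))
      = if i = j then 1 else 0 := fun i j => by
    rw [← Ad_inclLie hH, ← Ad_inclLie hH, hB.invariant _ h⁻¹.2, hA.orthonormal]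
  refine sum_bilin_eq_of_orthonormal (T := T) (e := fun k => inclLie n p H (A k)) hB.symm hA.orthonormal horth ?_
  refine (Submodule.eq_of_le_of_finrank_eq ?_ ?_).symm
  · rw [Submodule.span_le, hA.span_eq]
    rintro _ ⟨k, rfl⟩
    exact ⟨_, rfl⟩
  · rw [finrank_of_orthonormal horth rfl, finrank_of_orthonormal hA.orthonormal rfl]

omit [LieGroup (𝓡 p) ∞ H] in
theorem contMDiff_coeff (hH : ContMDiff (𝓡 p) (𝓡 n) ∞ (Subtype.val : H → G))
    (Y Z : GroupLieAlgebra (𝓡 n) G) : ContMDiff (𝓡 p) 𝓘(ℝ, ℝ) ∞ (coeff H B Y Z) :=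
  contMDiff_linear_Ad hH (B.flip Z) Y

theorem lieDeriv_coeff (hH : ContMDiff (𝓡 p) (𝓡 n) ∞ (Subtype.val : H → G))
    (A : GroupLieAlgebra (𝓡 p) H) (Y Z : GroupLieAlgebra (𝓡 n) G) :
    lieDeriv A (coeff H B Y Z) = coeff H B ⁅inclLie n p H A, Y⁆ Z :=
  funext fun h => lieDeriv_linear_Ad hH (B.flip Z) A Y h

/-- Each derivative along `A k` brackets `A k` into `Y`, so `𝓛₀` acts on matrix coefficients through
minus the Casimir operator. This reduces the Poisson equation to inverting the latter. -/
theorem half_sumSquares_coeff (hH : ContMDiff (𝓡 p) (𝓡 n) ∞ (Subtype.val : H → G))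
    (Y Z : GroupLieAlgebra (𝓡 n) G) (h : H) :
    (1 / 2) * sumSquares A (coeff H B Y Z) h
      = -coeff H B (casimir (fun k => inclLie n p H (A k)) Y) Z h := by
  simp only [sumSquares, lieDeriv_coeff hH]
  simp [coeff, casimir]

theorem isPoissonSolution_coeff_neg (hH : ContMDiff (𝓡 p) (𝓡 n) ∞ (Subtype.val : H → G))
    (X Z : GroupLieAlgebra (𝓡 n) G) :
    IsPoissonSolution H A (coeff H B (casimir (fun k => inclLie n p H (A k)) X) Z)
      (coeff H B (-X) Z) where
  smooth := contMDiff_coeff hH _ _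
  eq h := by
    rw [half_sumSquares_coeff hH, ← casimirLinear_apply, ← casimirLinear_apply, map_neg]
    simp [coeff]

section Integral

variable [CompactSpace H] [MeasurableSpace H] [BorelSpace H] (μ : Measure H) [μ.IsHaarMeasure]
  [IsProbabilityMeasure μ]

omit [LieGroup (𝓡 p) ∞ H] [μ.IsHaarMeasure] in
theorem integrable_coeff_mul_coeff (hH : ContMDiff (𝓡 p) (𝓡 n) ∞ (Subtype.val : H → G))
    (X Y Z Z' : GroupLieAlgebra (𝓡 n) G) :
    Integrable (fun h => coeff H B X Z h * coeff H B Y Z' h) μ :=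
  integrable_of_continuous_of_compactSpace μ
    ((contMDiff_coeff hH X Z).continuous.mul (contMDiff_coeff hH Y Z').continuous)

/-- The correlation `∫ α(X, Z) α(Y, Z')` of matrix coefficients, as a bilinear form in `Z`, `Z'`. -/
noncomputable def correlation (hH : ContMDiff (𝓡 p) (𝓡 n) ∞ (Subtype.val : H → G))
    (B : LinearMap.BilinForm ℝ (GroupLieAlgebra (𝓡 n) G))
    (X Y : GroupLieAlgebra (𝓡 n) G) : LinearMap.BilinForm ℝ (GroupLieAlgebra (𝓡 n) G) :=
  LinearMap.mk₂ ℝ (fun Z Z' => ∫ h, coeff H B X Z h * coeff H B Y Z' h ∂μ)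
    (fun Z₁ Z₂ Z' => by
      rw [← integral_add (integrable_coeff_mul_coeff μ hH X Y Z₁ Z')
        (integrable_coeff_mul_coeff μ hH X Y Z₂ Z')]
      simp only [coeff, map_add, add_mul])
    (fun c Z Z' => by
      rw [smul_eq_mul, ← integral_const_mul]
      simp only [coeff, map_smul, smul_eq_mul, mul_assoc])
    (fun Z Z₁ Z₂ => by
      rw [← integral_add (integrable_coeff_mul_coeff μ hH X Y Z Z₁)
        (integrable_coeff_mul_coeff μ hH X Y Z Z₂)]
      simp only [coeff, map_add, mul_add])
    (fun c Z Z' => by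
      rw [smul_eq_mul, ← integral_const_mul]
      simp only [coeff, map_smul, smul_eq_mul, mul_left_comm])

omit [LieGroup (𝓡 p) ∞ H] [μ.IsHaarMeasure] in
theorem correlation_apply (hH : ContMDiff (𝓡 p) (𝓡 n) ∞ (Subtype.val : H → G))
    (X Y Z Z' : GroupLieAlgebra (𝓡 n) G) :
    correlation μ hH B X Y Z Z' = ∫ h, coeff H B X Z h * coeff H B Y Z' h ∂μ := rfl

/-- The coefficient of the Casimir image of `X` is `-𝓛₀` of that of `X`, so this is the symmetry of
`𝓛₀`. It supplies the symmetry required by the real Schur lemma. -/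
theorem correlation_casimir_symm (hH : ContMDiff (𝓡 p) (𝓡 n) ∞ (Subtype.val : H → G))
    (X Z Z' : GroupLieAlgebra (𝓡 n) G) :
    correlation μ hH B X (casimir (fun k => inclLie n p H (A k)) X) Z Z'
      = correlation μ hH B X (casimir (fun k => inclLie n p H (A k)) X) Z' Z := by
  have e : ∀ W, coeff H B (casimir (fun k => inclLie n p H (A k)) X) W
      = fun h => -(1 / 2) * sumSquares A (coeff H B X W) h := fun W => funext fun h => by
    rw [neg_mul, half_sumSquares_coeff hH, neg_neg]
  simp only [correlation_apply, e, mul_left_comm _ (-(1 / 2) : ℝ), integral_const_mul]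
  rw [← integral_sumSquares_mul μ A (contMDiff_coeff hH X Z) (contMDiff_coeff hH X Z')]
  simp only [mul_comm]

omit [IsProbabilityMeasure μ] [ChartedSpace (EuclideanSpace ℝ (Fin p)) H] [LieGroup (𝓡 p) ∞ H]
  [CompactSpace H] in
-- Invariance of `B` moves `Ad k` across as a left translation of `h` by `k⁻¹`, which Haar measure
-- absorbs.
theorem integral_coeff_mul_coeff_Ad [IsTopologicalGroup H] (hB : IsInvariantInnerProduct H B) (k : H)
    (X Y Z Z' : GroupLieAlgebra (𝓡 n) G) :
    ∫ h, coeff H B X (Ad n (k : G) Z) h * coeff H B Y (Ad n (k : G) Z') h ∂μ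
      = ∫ h, coeff H B X Z h * coeff H B Y Z' h ∂μ := by
  have e : ∀ X Z h, coeff H B X (Ad n (k : G) Z) h = coeff H B X Z (k⁻¹ * h) := fun X Z h => by
    rw [coeff, coeff, Subgroup.coe_mul, Ad_mul, ← hB.invariant k k.2 (Ad n ((k⁻¹ : H) : G) _),
      Subgroup.coe_inv, Ad_mul_inv_apply]
  simp only [e]
  exact integral_mul_left_eq_self (fun h => coeff H B X Z h * coeff H B Y Z' h) k⁻¹

/-- The matrix of the effective generator in terms of a preimage `X` of `Y₀` under the Casimir
operator. -/
theorem neg_integral_coeff_mul_eq_correlation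
    (hH : ContMDiff (𝓡 p) (𝓡 n) ∞ (Subtype.val : H → G)) {X Z Z' : GroupLieAlgebra (𝓡 n) G}
    {β : H → ℝ}
    (hβ : IsPoissonSolution H A (coeff H B (casimir (fun k => inclLie n p H (A k)) X) Z') β) :
    -∫ h, coeff H B (casimir (fun k => inclLie n p H (A k)) X) Z h * β h ∂μ
      = correlation μ hH B X (casimir (fun k => inclLie n p H (A k)) X) Z Z' := by
  have e₁ : ∀ h, coeff H B (casimir (fun k => inclLie n p H (A k)) X) Z h * β h
      = -(1 / 2) * (sumSquares A (coeff H B X Z) h * β h) := fun h => by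
    rw [← mul_assoc, neg_mul, half_sumSquares_coeff hH, neg_neg]
  have e₂ : ∀ h, coeff H B X Z h * coeff H B (casimir (fun k => inclLie n p H (A k)) X) Z' h
      = (1 / 2) * (coeff H B X Z h * sumSquares A β h) := fun h => by
    rw [← hβ.eq h]
    ring
  rw [correlation_apply]
  simp only [e₁, e₂, integral_const_mul]
  -- Moving `𝓛₀` from the coefficient of `X` onto `β` leaves only `𝓛₀ β`; hence the choice of
  -- solution is immaterial.
  rw [integral_sumSquares_mul μ A (contMDiff_coeff hH X Z) hβ.smooth]
  ring

end Integral

end Subgroup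

/-! ### Sums of squares expanded in a larger orthonormal family -/

section SumSquares

variable {n : ℕ} {G : Type*} [TopologicalSpace G] [Group G]
  [ChartedSpace (EuclideanSpace ℝ (Fin n)) G] [LieGroup (𝓡 n) ∞ G]
  {B : LinearMap.BilinForm ℝ (GroupLieAlgebra (𝓡 n) G)}

/-- The expansion coefficients are constants, so they pass through both derivatives. For orthonormal
`W` the matrix is that of the orthogonal projection onto the span of `W`. -/
theorem sumSquares_eq_of_orthonormal {d q : ℕ} {W : Fin d → GroupLieAlgebra (𝓡 n) G}
    {Z : Fin q → GroupLieAlgebra (𝓡 n) G} (hZ : ∀ i j, B (Z i) (Z j) = if i = j then 1 else 0)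
    (hWZ : ∀ m, W m ∈ Submodule.span ℝ (Set.range Z)) {f : G → ℝ}
    (hf : ContMDiff (𝓡 n) 𝓘(ℝ, ℝ) 2 f) (g : G) :
    sumSquares W f g = ∑ i, ∑ j, (∑ m, B (W m) (Z i) * B (W m) (Z j)) *
      lieDeriv (Z i) (lieDeriv (Z j) f) g := by
  have hd : ∀ X : GroupLieAlgebra (𝓡 n) G, MDifferentiableAt (𝓡 n) 𝓘(ℝ, ℝ) (lieDeriv X f) g :=
    fun X => (contMDiff_lieDeriv (r := 1) (s := 2) (by norm_num) (by exact_mod_cast hf)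
      X).mdifferentiable (by simp) g
  have h₁ : ∀ m, lieDeriv (W m) f = fun g => ∑ j, B (W m) (Z j) * lieDeriv (Z j) f g := fun m => by
    ext g
    conv_lhs => rw [eq_sum_of_orthonormal hZ (hWZ m)]
    rw [lieDeriv_sum_left]
  have h₂ : ∀ m, lieDeriv (W m) (lieDeriv (W m) f) g = ∑ i, ∑ j, B (W m) (Z i) * B (W m) (Z j) *
      lieDeriv (Z i) (lieDeriv (Z j) f) g := fun m => by
    conv_lhs => rw [eq_sum_of_orthonormal hZ (hWZ m)]
    rw [lieDeriv_sum_left, ← eq_sum_of_orthonormal hZ (hWZ m), h₁ m]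
    refine Finset.sum_congr rfl fun i _ => ?_
    rw [lieDeriv_fun_sum _ _ fun j _ => hd (Z j), Finset.mul_sum]
    refine Finset.sum_congr rfl fun j _ => ?_
    ring
  simp only [sumSquares, h₂]
  rw [Finset.sum_comm]
  refine Finset.sum_congr rfl fun i _ => ?_
  rw [Finset.sum_comm]
  simp only [Finset.sum_mul]

end SumSquares

/-! ### The effective generator by Schur's lemma and a trace -/

section EffectiveGenerator

variable {n p : ℕ} {G : Type*} [TopologicalSpace G] [Group G]
  [ChartedSpace (EuclideanSpace ℝ (Fin n)) G] [LieGroup (𝓡 n) ∞ G]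
  {H : Subgroup G} [ChartedSpace (EuclideanSpace ℝ (Fin p)) H] [LieGroup (𝓡 p) ∞ H]
  {B : LinearMap.BilinForm ℝ (GroupLieAlgebra (𝓡 n) G)}
  {N : ℕ} {A : Fin N → GroupLieAlgebra (𝓡 p) H}
  {U : Submodule ℝ (GroupLieAlgebra (𝓡 n) G)} {d : ℕ} {W : Fin d → GroupLieAlgebra (𝓡 n) G}

omit [ChartedSpace (EuclideanSpace ℝ (Fin p)) H] [LieGroup (𝓡 p) ∞ H] in
theorem exists_eq_mul_of_isAdIrreducible (hB : IsInvariantInnerProduct H B)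
    (hU : IsAdIrreducible H U) (hW : IsOrthonormalBasisOf B U W)
    {S : LinearMap.BilinForm ℝ (GroupLieAlgebra (𝓡 n) G)}
    (hsymm : ∀ X ∈ U, ∀ X' ∈ U, S X X' = S X' X)
    (hS : ∀ h : H, ∀ X ∈ U, ∀ X' ∈ U, S (Ad n (h : G) X) (Ad n (h : G) X') = S X X') :
    ∃ κ : ℝ, ∀ X ∈ U, ∀ X' ∈ U, S X X' = κ * B X X' :=
  exists_eq_mul_of_irreducible (ρ := fun h : H => Ad n (h : G))
    (fun h X => Ad_mul_inv_apply (h : G) X) (fun h X hX => hU.invariant h h.2 X hX) hU.ne_bot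
    (fun V hV hinv => hU.eq_bot_or_eq V hV fun h hh X hX => hinv ⟨h, hh⟩ X hX)
    (fun h X X' => hB.invariant h h.2 X X') hW.orthonormal hW.span_eq hsymm hS

/-- The effective generator is a multiple of the sum of squares on an irreducible subspace. -/
theorem effectiveGenerator_eq [CompactSpace H] [MeasurableSpace H] [BorelSpace H] (μ : Measure H)
    [μ.IsHaarMeasure] [IsProbabilityMeasure μ]
    (hH : ContMDiff (𝓡 p) (𝓡 n) ∞ (Subtype.val : H → G)) (hB : IsInvariantInnerProduct H B)
    (hU : IsAdIrreducible H U) (hW : IsOrthonormalBasisOf B U W)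
    {V : Submodule ℝ (GroupLieAlgebra (𝓡 n) G)} (hUV : U ≤ V) {q : ℕ}
    {Z : Fin q → GroupLieAlgebra (𝓡 n) G} (hZ : IsOrthonormalBasisOf B V Z)
    {X Y₀ : GroupLieAlgebra (𝓡 n) G} (hX : X ∈ U)
    (hXY : casimir (fun k => inclLie n p H (A k)) X = Y₀) {β : Fin q → H → ℝ}
    (hβ : ∀ j, IsPoissonSolution H A (coeff H B Y₀ (Z j)) (β j)) {f : G → ℝ}
    (hf : ContMDiff (𝓡 n) 𝓘(ℝ, ℝ) 2 f) (g : G) :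
    effectiveGenerator H μ B Y₀ Z β f g
      = B X Y₀ / (Module.finrank ℝ U : ℝ) * sumSquares W f g := by
  have : IsTopologicalGroup H := topologicalGroup_of_lieGroup (𝓡 p) ∞
  have hWU : ∀ m, W m ∈ U := fun m => hW.span_eq ▸ Submodule.subset_span ⟨m, rfl⟩
  have hY₀ : Y₀ ∈ U := hXY ▸ casimir_mem_of_isAdInvariant hH hU.invariant hX
  obtain ⟨κ, hκ⟩ := exists_eq_mul_of_isAdIrreducible hB hU hW (S := correlation μ hH B X Y₀)
    (fun Z _ Z' _ => by
      subst hXY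
      exact correlation_casimir_symm μ hH X Z Z')
    (fun h Z _ Z' _ => integral_coeff_mul_coeff_Ad μ hB h X Y₀ Z Z')
  -- The trace of the correlation form is the integral of `B (Ad h X) (Ad h Y₀)` by Parseval in `U`,
  -- and this integrand is the constant `B X Y₀`.
  have htrace : κ * d = B X Y₀ := by
    have h₁ : ∑ m, correlation μ hH B X Y₀ (W m) (W m) = κ * d := by
      simp [hκ _ (hWU _) _ (hWU _), hW.orthonormal, mul_comm]
    rw [← h₁]
    simp only [correlation_apply]
    rw [← integral_finsetSum _ fun m _ => integrable_coeff_mul_coeff μ hH X Y₀ (W m) (W m)]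
    have h₂ : ∀ h : H, ∑ m, coeff H B X (W m) h * coeff H B Y₀ (W m) h = B X Y₀ := fun h => by
      rw [← hB.invariant h h.2, bilin_eq_sum_of_orthonormal hW.orthonormal (X := Ad n (h : G) X)
        (hW.span_eq ▸ hU.invariant h h.2 X hX)]
      simp only [coeff, hB.symm (W _)]
    simp [h₂]
  have hd : (d : ℝ) ≠ 0 := by
    rintro h
    rw [Nat.cast_eq_zero] at h
    subst h
    exact hU.ne_bot (by rw [← hW.span_eq, Set.range_eq_empty, Submodule.span_empty])
  -- As `Ad h Y` stays in `U`, only the orthogonal projection of `Z'` onto `U` matters. This brings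
  -- the `Z i`, which need not lie in `U`, within reach of Schur's lemma.
  have hproj : ∀ Y ∈ U, ∀ Z', coeff H B Y Z' = coeff H B Y (∑ m, B (W m) Z' • W m) :=
    fun Y hY Z' => funext fun h => by
      rw [coeff, bilin_eq_sum_of_orthonormal hW.orthonormal (hW.span_eq ▸ hU.invariant h h.2 Y hY)]
      simp [coeff, mul_comm]
  have hcorr : ∀ i j, correlation μ hH B X Y₀ (Z i) (Z j)
      = κ * ∑ m, B (W m) (Z i) * B (W m) (Z j) := fun i j => by
    have hmem : ∀ Z', ∑ m, B (W m) Z' • W m ∈ U := fun Z' =>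
      U.sum_mem fun m _ => U.smul_mem _ (hWU m)
    rw [correlation_apply, hproj X hX (Z i), hproj Y₀ hY₀ (Z j), ← correlation_apply μ hH,
      hκ _ (hmem _) _ (hmem _)]
    simp [hW.orthonormal, mul_comm]
  have hcoef : ∀ i j, -∫ h, coeff H B Y₀ (Z i) h * β j h ∂μ
      = κ * ∑ m, B (W m) (Z i) * B (W m) (Z j) := fun i j => by
    rw [← hcorr]
    subst hXY
    exact neg_integral_coeff_mul_eq_correlation μ hH (hβ j)
  rw [sumSquares_eq_of_orthonormal hZ.orthonormal (fun m => hZ.span_eq ▸ hUV (hWU m)) hf,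
    finrank_of_orthonormal hW.orthonormal hW.span_eq, ← htrace, mul_div_cancel_right₀ _ hd,
    effectiveGenerator]
  simp only [hcoef, Finset.mul_sum]
  refine Finset.sum_congr rfl fun i _ => Finset.sum_congr rfl fun j _ => ?_
  rw [← Finset.mul_sum, mul_assoc]

end EffectiveGenerator

end EffectiveLimit

/-! ### The theorem: inverting the Casimir operator on `𝔪 l` -/

theorem mainTheorem3 {n p : ℕ} {G : Type*} [TopologicalSpace G] [T2Space G] [Group G]
    [ChartedSpace (EuclideanSpace ℝ (Fin n)) G] [LieGroup (𝓡 n) ∞ G]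
    -- `H` is a compact connected (embedded) Lie subgroup of `G`
    (H : Subgroup G) [ChartedSpace (EuclideanSpace ℝ (Fin p)) H] [LieGroup (𝓡 p) ∞ H]
    (_hH : Manifold.IsSmoothEmbedding (𝓡 p) (𝓡 n) ∞ (Subtype.val : H → G))
    [CompactSpace H] [ConnectedSpace H]
    -- `μ` is the normalised Haar measure of `H`
    [MeasurableSpace H] [BorelSpace H] (μ : Measure H) [μ.IsHaarMeasure] [IsProbabilityMeasure μ]
    -- an `Ad H`-invariant inner product and the decomposition `𝔪 = 𝔪₀ ⊕ ⋯ ⊕ 𝔪ᵣ`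
    (B : LinearMap.BilinForm ℝ (GroupLieAlgebra (𝓡 n) G))
    (_hB : EffectiveLimit.IsInvariantInnerProduct H B)
    {r : ℕ} (𝔪 : Fin (r + 1) → Submodule ℝ (GroupLieAlgebra (𝓡 n) G))
    (_h𝔪 : EffectiveLimit.IsIrreducibleDecomposition p H B 𝔪)
    -- Lie algebra generating elements of `𝔥`
    {N : ℕ} (A : Fin N → GroupLieAlgebra (𝓡 p) H)
    (_hA : EffectiveLimit.IsLieGenerating (n := n) H A)
    -- `Y₀ ∈ 𝔪ₗ` with `l ≠ 0`
    (l : Fin (r + 1)) (_hl : l ≠ 0) (Y₀ : GroupLieAlgebra (𝓡 n) G) (_hY₀ : Y₀ ∈ 𝔪 l)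
    -- an orthonormal basis `Z` of an invariant subspace `V` with `𝔪ₗ ⊆ V ⊆ 𝔪`
    (V : Submodule ℝ (GroupLieAlgebra (𝓡 n) G)) (_hV : EffectiveLimit.IsAdInvariant H V)
    (_hlV : 𝔪 l ≤ V) (_hVm : V ≤ EffectiveLimit.compl p H B)
    {q : ℕ} (Z : Fin q → GroupLieAlgebra (𝓡 n) G)
    (_hZ : EffectiveLimit.IsOrthonormalBasisOf B V Z)
    -- an orthonormal basis `W` of `𝔪ₗ`, so that `sumSquares W` is `Δ_{𝔪ₗ}`
    {d : ℕ} (W : Fin d → GroupLieAlgebra (𝓡 n) G)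
    (_hW : EffectiveLimit.IsOrthonormalBasisOf B (𝔪 l) W) :
    -- the Poisson equations that define the effective generator are solvable
    (∀ j, ∃ u, EffectiveLimit.IsPoissonSolution H A (EffectiveLimit.coeff H B Y₀ (Z j)) u) ∧
    -- and, for any choice of their solutions:
    ∀ β : Fin q → H → ℝ,
      (∀ j, EffectiveLimit.IsPoissonSolution H A (EffectiveLimit.coeff H B Y₀ (Z j)) (β j)) →
      (∀ (Y : Fin d → GroupLieAlgebra (𝓡 n) G) (lam c : Fin d → ℝ),
        EffectiveLimit.IsOrthonormalBasisOf B (𝔪 l) Y →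
        (∀ m, EffectiveLimit.casimir (fun k => EffectiveLimit.inclLie n p H (A k)) (Y m)
          = lam m • Y m) →
        Y₀ = ∑ m, c m • Y m →
        (∀ m, 0 < lam m) ∧
        ∀ f : G → ℝ, ContMDiff (𝓡 n) 𝓘(ℝ, ℝ) 2 f → ∀ g,
          EffectiveLimit.effectiveGenerator H μ B Y₀ Z β f g =
            (1 / (Module.finrank ℝ (𝔪 l) : ℝ)) * (∑ m, c m ^ 2 / lam m) *
              EffectiveLimit.sumSquares W f g) ∧
      (EffectiveLimit.IsOrthonormalBasisOf B (EffectiveLimit.subLie n p H)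
          (fun k => EffectiveLimit.inclLie n p H (A k)) →
        ∃ laml : ℝ, 0 < laml ∧
          (∀ X ∈ 𝔪 l, EffectiveLimit.casimir (fun k => EffectiveLimit.inclLie n p H (A k)) X
            = laml • X) ∧
          ∀ f : G → ℝ, ContMDiff (𝓡 n) 𝓘(ℝ, ℝ) 2 f → ∀ g,
            EffectiveLimit.effectiveGenerator H μ B Y₀ Z β f g =
              B Y₀ Y₀ / ((Module.finrank ℝ (𝔪 l) : ℝ) * laml) *
                EffectiveLimit.sumSquares W f g) := by
  have hval := _hH.contMDiff
  have hirr := _h𝔪.irreducible l _hl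
  have hfix : ∀ X ∈ 𝔪 l, X ≠ 0 → ¬∀ h ∈ H, EffectiveLimit.Ad n h X = X := fun X hX hne h => by
    have h₀ : X ∈ 𝔪 0 := (_h𝔪.mem_zero_iff X).2 ⟨_hVm (_hlV hX), h⟩
    exact (_hB.pos X hne).ne' (_h𝔪.orthogonal l 0 _hl X hX X h₀)
  have hpos : ∀ X ∈ 𝔪 l, X ≠ 0 →
      0 < B (EffectiveLimit.casimir (fun k => EffectiveLimit.inclLie n p H (A k)) X) X :=
    fun X hX hne => EffectiveLimit.bilin_casimir_self_pos hval _hB _hA (hfix X hX hne)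
  obtain ⟨X, hX, hXY⟩ : ∃ X ∈ 𝔪 l,
      EffectiveLimit.casimir (fun k => EffectiveLimit.inclLie n p H (A k)) X = Y₀ := by
    let C := (EffectiveLimit.casimirLinear fun k => EffectiveLimit.inclLie n p H (A k)).restrict
      (p := 𝔪 l) (q := 𝔪 l)
      fun X hX => EffectiveLimit.casimir_mem_of_isAdInvariant hval hirr.invariant hX
    have hinj : Function.Injective C := by
      rw [injective_iff_map_eq_zero]
      intro X hX
      by_contra hne
      have := hpos X X.2 (by simpa using hne)
      have hz : EffectiveLimit.casimir (fun k => EffectiveLimit.inclLie n p H (A k)) X = 0 :=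
        congrArg Subtype.val hX
      rw [hz] at this
      simp at this
    obtain ⟨X, hX⟩ := LinearMap.injective_iff_surjective.1 hinj ⟨Y₀, _hY₀⟩
    exact ⟨X, X.2, congrArg Subtype.val hX⟩
  refine ⟨fun j => ⟨_, hXY ▸ EffectiveLimit.isPoissonSolution_coeff_neg hval X (Z j)⟩,
    fun β hβ => ⟨fun Y lam c hY hlam hc => ?_, fun hA => ?_⟩⟩
  · have hYm : ∀ m, Y m ∈ 𝔪 l := fun m => hY.span_eq ▸ Submodule.subset_span ⟨m, rfl⟩
    have hlampos : ∀ m, 0 < lam m := fun m => by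
      have hm : B (Y m) (Y m) = 1 := by simp [hY.orthonormal]
      have := hpos (Y m) (hYm m) (by
        intro h
        rw [h] at hm
        simp at hm)
      rwa [hlam, map_smul, LinearMap.smul_apply, hm, smul_eq_mul, mul_one] at this
    refine ⟨hlampos, fun f hf g => ?_⟩
    -- The Casimir preimage of `Y₀`, written in the eigenbasis.
    have hX' : ∑ m, (c m / lam m) • Y m ∈ 𝔪 l := (𝔪 l).sum_mem fun m _ => (𝔪 l).smul_mem _ (hYm m)
    have hCX' : EffectiveLimit.casimir (fun k => EffectiveLimit.inclLie n p H (A k))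
        (∑ m, (c m / lam m) • Y m) = Y₀ := by
      rw [← EffectiveLimit.casimirLinear_apply, map_sum, hc]
      refine Finset.sum_congr rfl fun m _ => ?_
      rw [map_smul, EffectiveLimit.casimirLinear_apply, hlam, smul_smul,
        div_mul_cancel₀ _ (hlampos m).ne']
    rw [EffectiveLimit.effectiveGenerator_eq μ hval _hB hirr _hW _hlV _hZ hX' hCX' hβ hf]
    congr 1
    have hBX : B (∑ m, (c m / lam m) • Y m) Y₀ = ∑ m, c m ^ 2 / lam m := by
      rw [hc]
      simp only [map_sum, map_smul, LinearMap.sum_apply, LinearMap.smul_apply, smul_eq_mul,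
        hY.orthonormal, mul_ite, mul_one, mul_zero, Finset.sum_ite_eq', Finset.mem_univ, if_true]
      refine Finset.sum_congr rfl fun m _ => ?_
      ring
    rw [hBX]
    ring
  · obtain ⟨κ, hκ⟩ := EffectiveLimit.exists_eq_mul_of_isAdIrreducible _hB hirr _hW
      (S := B ∘ₗ EffectiveLimit.casimirLinear fun k => EffectiveLimit.inclLie n p H (A k))
      (fun X _ X' _ => by
        simp only [LinearMap.comp_apply, EffectiveLimit.casimirLinear_apply,
          EffectiveLimit.bilin_casimir hval _hB]
        simp only [_hB.symm ⁅_, X⁆])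
      (fun h X _ X' _ => EffectiveLimit.bilin_casimir_Ad hval _hB hA h X X')
    -- The difference of the two sides lies in `𝔪 l` and is orthogonal to `𝔪 l`, hence to itself.
    have hscalar : ∀ X ∈ 𝔪 l,
        EffectiveLimit.casimir (fun k => EffectiveLimit.inclLie n p H (A k)) X = κ • X :=
      fun X hX => by
        by_contra hne
        have hmem := (𝔪 l).sub_mem (EffectiveLimit.casimir_mem_of_isAdInvariant (A := A) hval
          hirr.invariant hX) ((𝔪 l).smul_mem κ hX)
        have h := hκ X hX _ hmem
        refine (_hB.pos _ (sub_ne_zero.2 hne)).ne' ?_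
        rw [LinearMap.map_sub₂, LinearMap.map_smul₂, smul_eq_mul, sub_eq_zero]
        exact h
    obtain ⟨X₁, hX₁, hne⟩ := (𝔪 l).ne_bot_iff.1 hirr.ne_bot
    have hκpos : 0 < κ := by
      have := hpos X₁ hX₁ hne
      rw [hscalar X₁ hX₁, map_smul, LinearMap.smul_apply, smul_eq_mul] at this
      exact pos_of_mul_pos_left this (_hB.pos X₁ hne).le
    refine ⟨κ, hκpos, hscalar, fun f hf g => ?_⟩
    -- With the Casimir operator equal to `κ` on `𝔪 l`, the preimage of `Y₀` is `κ⁻¹ • Y₀`.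
    rw [EffectiveLimit.effectiveGenerator_eq μ hval _hB hirr _hW _hlV _hZ
      ((𝔪 l).smul_mem κ⁻¹ _hY₀) (by
        rw [hscalar _ ((𝔪 l).smul_mem κ⁻¹ _hY₀), smul_smul, mul_inv_cancel₀ hκpos.ne', one_smul])
      hβ hf]
    congr 1
    rw [map_smul, LinearMap.smul_apply, smul_eq_mul]
    field_simp
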